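/- Let $d\ge 1$. Let $X$ be a non-negative random field on $\mathbb{R}^d$ with continuous sample paths and law $\mathbb{P}_X$ on $C(\mathbb{R}^d)$ (the storm process), let $\Psi$ be a random field on $\mathbb{R}^d$ with continuous sample paths that is almost surely strictly positive (the intensity process), and let $\mu_Y>0$. Assume that (a) for some constants $C,R>0$, almost surely $X\le C\,\mathbf{1}_{B_R(o)}$, where $B_R(o)$ is the closed ball of radius $R$ centred at the origin $o$; (b) there is $r>0$ such that $\mathbb{P}_X\big(B_r(o)\subset\{s: X(s)>0\}\big)>0$; (c) almost surely $X(s)>0$ for all $s\in\mathbb{R}^d$ with $\|s\|<R$. Let $N=\sum_i\delta_{(s_i,u_i,X_i)}$ be a Cox process that, conditionally on $\Psi=\psi$, is a Poisson process on $\mathbb{R}^d\times(0,\infty)\times C(\mathbb{R}^d)$ with directing measure $\mu_Y^{-1}\psi(s)\,ds\;u^{-2}du\;d\mathbb{P}_X$, and let $Y(t)=\bigvee_i u_iX_i(t-s_i)$. Let $Y^*$ be, conditionally on $\Psi=\psi$, a copy of $Y$ that is independent of $N$. Let $K\subset\mathbb{R}^d$ be compact, put $K_\rho=\{t+v: t\in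 K,\ \|v\|\le\rho\}$ (empty for $\rho<0$), and let $$N_K^{Y^*}=\sum_i\delta_{s_i}\mathbf{1}\Big\{\sup_{t\in K}X_i(t-s_i)/Y^*(t)\ge u_i^{-1}\Big\}.$$ For a realization $\psi$ of $\Psi$ and a realization $y$ of $Y^*$ put $$b_K^y(s)=\mu_Y^{-1}\,\mathbb{E}_X\Big[\sup_{t\in K}\frac{X(t-s)}{y(t)}\Big],\qquad c_K^y=\int_{\mathbb{R}^d} b_K^y(s)\psi(s)\,ds .$$ Given $\Psi=\psi$ and $Y^*=y$, let $\varphi_1,\varphi_2,\dots$ be i.i.d. realizations of the point process $N_K^{Y^*}$ conditioned on $\Psi=\psi$, $Y^*=y$, and let $t_1,\dots,t_{m_n}$ be the points of $\varphi_1+\dots+\varphi_n$. Let $k:\mathbb{R}^d\to\mathbb{R}$ be a measurable kernel with $\int k(s)\,ds=1$ that is continuous almost everywhere and satisfies $|k(s)|\le L(\|s\|)$ for some nonincreasing $L$ on $[0,\infty)$ such that $s\mapsto L(\|s\|)$ is integrable on $\mathbb{R}^d$. Let $h_n>0$ be bandwidths with $h_n\to0$ and $nh_n^d/|\log n|\to\infty$,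 and define $$\widehat\psi_{K,n}(s)=\big[b_K^y(s)\big]^{-1}\,\frac{1}{m_nh_{m_n}^d}\sum_{i=1}^{m_n}k\Big(\frac{s-t_i}{h_{m_n}}\Big).$$ Then, for almost every realization $\psi$ of $\Psi$ and almost every realization $y$ of $Y^*$ given $\Psi=\psi$, almost surely for all $\varepsilon>0$ $$\sup_{s\in K_{R-\varepsilon}}\big|c_K^y\,\widehat\psi_{K,n}(s)-\psi(s)\big|\longrightarrow 0\qquad(n\to\infty).$$ -/

import Mathlib

open MeasureTheory ProbabilityTheory Filter Topology
open scoped ENNReal NNReal Pointwise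

noncomputable section

namespace CoxExtremal

/-- Euclidean space `ℝ^d`. -/
abbrev E (d : ℕ) : Type := EuclideanSpace ℝ (Fin d)

/-- The path space `C(ℝ^d)` carries the topology of locally uniform convergence (Mathlib's
compact-open topology) and its Borel `σ`-algebra. -/
instance pathMeasurableSpace (d : ℕ) : MeasurableSpace C(E d, ℝ) := borel _

instance pathBorelSpace (d : ℕ) : BorelSpace C(E d, ℝ) := ⟨rfl⟩

/-- A storm `(s, u, X)`: centre `s`, severity `u`, shape `X`. (Severities live on `(0, ∞)`: the
directing measure `stormIntensity` gives no mass to other values of `u`.) -/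
abbrev Storm (d : ℕ) : Type := E d × ℝ × C(E d, ℝ)

/-- The counting measure `∑ i, δ_{x i}` of a sequence of points. -/
def pointMeasure {S : Type*} [MeasurableSpace S] (x : ℕ → S) : Measure S :=
  Measure.sum fun i => Measure.dirac (x i)

/-- The point process `∑ i, δ_{x i}` on the probability space `(Ω, P)` is a Poisson process with
directing measure `Λ`: the number of points in a measurable set `B` with `Λ B < ∞` is Poisson
distributed with parameter `Λ B`, and the numbers of points in pairwise disjoint measurable sets
are independent. -/
structure IsPoissonProcess {Ω S : Type*} [MeasurableSpace Ω] [MeasurableSpace S]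
    (P : Measure Ω) (x : ℕ → Ω → S) (Λ : Measure S) : Prop where
  measurable : ∀ i, Measurable (x i)
  count_law : ∀ B : Set S, MeasurableSet B → Λ B < ∞ →
    P.map (fun ω => pointMeasure (fun i => x i ω) B) =
      (poissonMeasure (Λ B).toNNReal).map (fun n : ℕ => (n : ℝ≥0∞))
  count_indep : ∀ (m : ℕ) (B : Fin m → Set S), (∀ l, MeasurableSet (B l)) →
    Pairwise (Function.onFun Disjoint B) →
    iIndepFun (fun l ω => pointMeasure (fun i => x i ω) (B l)) P

/-- The point processes `∑ i, δ_{x j i}`, `j = 0, 1, 2, …`, are independent Poisson processes with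
the same directing measure `Λ`. -/
structure IsIIDPoisson {Ω S : Type*} [MeasurableSpace Ω] [MeasurableSpace S]
    (P : Measure Ω) (x : ℕ → ℕ → Ω → S) (Λ : Measure S) : Prop where
  poisson : ∀ j, IsPoissonProcess P (x j) Λ
  indep : iIndepFun (fun j ω => pointMeasure (fun i => x j i ω)) P

/-- The measure `μ⁻¹ ψ(s) ds × u⁻² du × P_X(dX)` on storms, `u > 0`. -/
def stormIntensity {d : ℕ} (μ : ℝ) (PX : Measure C(E d, ℝ)) (ψ : C(E d, ℝ)) :
    Measure (Storm d) :=
  ENNReal.ofReal μ⁻¹ •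
    ((volume.withDensity fun s : E d => ENNReal.ofReal (ψ s)).prod
      (((volume.restrict (Set.Ioi (0 : ℝ))).withDensity
        fun u => ENNReal.ofReal (u ^ 2)⁻¹).prod PX))

/-- The extremal field `Y(t) = ⋁ i, u_i X_i(t - s_i)` of a sequence of storms. -/
def extremalField {d : ℕ} (x : ℕ → Storm d) (t : E d) : ℝ≥0∞ :=
  ⨆ i, ENNReal.ofReal ((x i).2.1 * (x i).2.2 (t - (x i).1))

/-- `sup_{t ∈ K} X(t - s) / y(t)`. -/
def supRatio {d : ℕ} (K : Set (E d)) (y : E d → ℝ≥0∞) (s : E d) (X : C(E d, ℝ)) : ℝ≥0∞ :=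
  ⨆ t ∈ K, ENNReal.ofReal (X (t - s)) / y t

/-- The storm `p = (s, u, X)` is retained by the threshold `y` on `K`:
`sup_{t ∈ K} X(t - s) / y(t) ≥ u⁻¹`. -/
def Contributes {d : ℕ} (K : Set (E d)) (y : E d → ℝ≥0∞) (p : Storm d) : Prop :=
  (ENNReal.ofReal p.2.1)⁻¹ ≤ supRatio K y p.1 p.2.2

/-- The correcting factor `b_K^y(s) = μ⁻¹ 𝔼_X [sup_{t ∈ K} X(t - s) / y(t)]`. -/
def bFactor {d : ℕ} (μ : ℝ) (PX : Measure C(E d, ℝ)) (K : Set (E d)) (y : E d → ℝ≥0∞)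
    (s : E d) : ℝ≥0∞ :=
  ENNReal.ofReal μ⁻¹ * ∫⁻ X, supRatio K y s X ∂PX

/-- The constant `c_K^y = ∫ b_K^y(s) ψ(s) ds`. -/
def cConst {d : ℕ} (μ : ℝ) (PX : Measure C(E d, ℝ)) (ψ : C(E d, ℝ)) (K : Set (E d))
    (y : E d → ℝ≥0∞) : ℝ :=
  (∫⁻ s, bFactor μ PX K y s * ENNReal.ofReal (ψ s)).toReal

/-- The indices `(j, i)` of the points of `φ_0 + ⋯ + φ_{n-1}`, where `φ_j` consists of the centres
of those storms of the `j`-th storm process that are retained by the threshold `y` on `K`. -/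
def sampleIndex {d : ℕ} (K : Set (E d)) (y : E d → ℝ≥0∞) (x : ℕ → ℕ → Storm d) (n : ℕ) :
    Set (ℕ × ℕ) :=
  {q | q.1 < n ∧ Contributes K y (x q.1 q.2)}

/-- The number `m_n` of points of `φ_0 + ⋯ + φ_{n-1}`. -/
def sampleCount {d : ℕ} (K : Set (E d)) (y : E d → ℝ≥0∞) (x : ℕ → ℕ → Storm d) (n : ℕ) : ℕ :=
  (sampleIndex K y x n).ncard

/-- The kernel estimator `(m_n h_{m_n}^d)⁻¹ ∑_t k((s - t) / h_{m_n})`, the sum being over the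
points `t` of `φ_0 + ⋯ + φ_{n-1}`. -/
def kernelEstimator {d : ℕ} (k : E d → ℝ) (h : ℕ → ℝ) (K : Set (E d)) (y : E d → ℝ≥0∞)
    (x : ℕ → ℕ → Storm d) (n : ℕ) (s : E d) : ℝ :=
  1 / ((sampleCount K y x n : ℝ) * h (sampleCount K y x n) ^ d) *
    ∑ᶠ q ∈ sampleIndex K y x n, k ((h (sampleCount K y x n))⁻¹ • (s - (x q.1 q.2).1))

/-- The corrected estimator: the kernel estimator divided by `b_K^y`. -/
def correctedEstimator {d : ℕ} (μ : ℝ) (PX : Measure C(E d, ℝ)) (k : E d → ℝ) (h : ℕ → ℝ)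
    (K : Set (E d)) (y : E d → ℝ≥0∞) (x : ℕ → ℕ → Storm d) (n : ℕ) (s : E d) : ℝ :=
  (bFactor μ PX K y s).toReal⁻¹ * kernelEstimator k h K y x n s

/-- A smoothing kernel on `ℝ^d`: it has integral one, is continuous almost everywhere, and is
dominated by an integrable radially nonincreasing function. -/
structure IsSmoothingKernel {d : ℕ} (k : E d → ℝ) : Prop where
  measurable : Measurable k
  integral_eq_one : ∫ s, k s = 1
  ae_continuousAt : ∀ᵐ s : E d, ContinuousAt k s
  dominated : ∃ L : ℝ → ℝ, AntitoneOn L (Set.Ici 0) ∧ (∀ s, |k s| ≤ L ‖s‖) ∧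
    Integrable (fun s : E d => L ‖s‖)

end CoxExtremal

end

/-!
Given the intensity `ψ` and the threshold `y`, the retained centres form a Poisson process with
intensity `f = b_K^y ψ`, which is continuous with compact support, so `φ_0 + ⋯ + φ_{n-1}` has
intensity `n f`. By the Chernoff bound, a union bound over the cells of a grid of mesh proportional
to `h_m`, and the Borel-Cantelli lemma, its cell counts are almost surely uniformly close to their
means, to a precision `o(n h_m^d)`. This holds simultaneously for all `m` comparable to `n`, and so
survives the substitution of the random `m_n ∼ c_K^y n` for `m`. A dominated, almost everywhere
continuous kernel is directly Riemann integrable: it lies between step functions with nearly equal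
integrals. Hence closeness on cells passes to the smoothings by `k`, and the smoothing of the mean
tends to `f` uniformly because `f` is uniformly continuous. Finally `b_K^y` is continuous and
positive on the compact set `K_{R-ε}`, so that `f` may be divided by it.
-/

namespace CoxExtremal

section PoissonDistribution

lemma poissonMeasure_zero : poissonMeasure 0 = Measure.dirac 0 := by
  refine Measure.ext_of_singleton fun k => ?_
  rw [poissonMeasure_singleton, Measure.dirac_apply' _ (measurableSet_singleton k)]
  cases k <;> simp

lemma integrable_exp_mul_poissonMeasure (r : ℝ≥0) (t : ℝ) :
    Integrable (fun k : ℕ => Real.exp (t * k)) (poissonMeasure r) := by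
  rw [integrable_poissonMeasure_iff]
  refine ((Real.summable_pow_div_factorial (r * Real.exp t)).mul_left (Real.exp (-r))).congr
    fun k => ?_
  rw [Real.norm_of_nonneg (Real.exp_pos _).le, mul_pow, ← Real.exp_nat_mul, mul_comm (k : ℝ) t]
  ring

lemma mgf_natCast_poissonMeasure (r : ℝ≥0) (t : ℝ) :
    mgf (fun k : ℕ => (k : ℝ)) (poissonMeasure r) t = Real.exp (r * (Real.exp t - 1)) := by
  have hterm : ∀ k : ℕ, (Real.exp (-r) * r ^ k / (k.factorial : ℝ)) • Real.exp (t * k) =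
      Real.exp (-r) * ((r * Real.exp t) ^ k / k.factorial) := fun k => by
    rw [smul_eq_mul, mul_pow, ← Real.exp_nat_mul, mul_comm (k : ℝ) t]
    ring
  rw [mgf, integral_poissonMeasure]
  simp_rw [hterm]
  rw [tsum_mul_left, ← congrFun (NormedSpace.exp_eq_tsum_div (𝔸 := ℝ)) _, ← Real.exp_eq_exp_ℝ,
    ← Real.exp_add]
  congr 1
  ring

lemma poissonMeasure_real_abs_sub_ge_le (r : ℝ≥0) {θ : ℝ} (hθ0 : 0 ≤ θ) (hθ1 : θ ≤ 1) (a : ℝ) :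
    (poissonMeasure r).real {k : ℕ | a ≤ |(k : ℝ) - r|} ≤ 2 * Real.exp (r * θ ^ 2 - θ * a) := by
  have hmgf : ∀ t : ℝ, |t| ≤ 1 →
      mgf (fun k : ℕ => (k : ℝ)) (poissonMeasure r) t ≤ Real.exp (r * (t + t ^ 2)) := fun t ht => by
    rw [mgf_natCast_poissonMeasure]
    have := (abs_le.1 (Real.abs_exp_sub_one_sub_id_le ht)).2
    gcongr
    linarith
  have upper : (poissonMeasure r).real {k : ℕ | r + a ≤ k} ≤ Real.exp (r * θ ^ 2 - θ * a) := by
    calc _ ≤ Real.exp (-θ * (r + a)) * mgf (fun k : ℕ => (k : ℝ)) (poissonMeasure r) θ :=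
          measure_ge_le_exp_mul_mgf _ hθ0 (integrable_exp_mul_poissonMeasure r θ)
      _ ≤ Real.exp (-θ * (r + a)) * Real.exp (r * (θ + θ ^ 2)) := by
          gcongr
          exact hmgf θ (by rwa [abs_of_nonneg hθ0])
      _ = Real.exp (r * θ ^ 2 - θ * a) := by rw [← Real.exp_add]; ring_nf
  have lower : (poissonMeasure r).real {k : ℕ | (k : ℝ) ≤ r - a} ≤
      Real.exp (r * θ ^ 2 - θ * a) := by
    calc _ ≤ Real.exp (-(-θ) * (r - a)) * mgf (fun k : ℕ => (k : ℝ)) (poissonMeasure r) (-θ) :=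
          measure_le_le_exp_mul_mgf _ (neg_nonpos.2 hθ0) (integrable_exp_mul_poissonMeasure r _)
      _ ≤ Real.exp (-(-θ) * (r - a)) * Real.exp (r * (-θ + (-θ) ^ 2)) := by
          gcongr
          exact hmgf (-θ) (by rwa [abs_neg, abs_of_nonneg hθ0])
      _ = Real.exp (r * θ ^ 2 - θ * a) := by rw [← Real.exp_add]; ring_nf
  have hsub : {k : ℕ | a ≤ |(k : ℝ) - r|} ⊆ {k : ℕ | r + a ≤ k} ∪ {k : ℕ | (k : ℝ) ≤ r - a} := by
    intro k hk
    rcases le_abs.1 (show a ≤ |(k : ℝ) - r| from hk) with hk | hk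
    · exact Or.inl (show (r : ℝ) + a ≤ k by linarith)
    · exact Or.inr (show (k : ℝ) ≤ r - a by linarith)
  linarith [(measureReal_mono (μ := poissonMeasure r) hsub).trans (measureReal_union_le _ _)]

end PoissonDistribution

section PointProcess

variable {Ω S : Type*} [MeasurableSpace Ω] [MeasurableSpace S] {P : Measure Ω} {Λ : Measure S}

lemma pointMeasure_apply {x : ℕ → S} {B : Set S} (hB : MeasurableSet B) :
    pointMeasure x B = ({i | x i ∈ B}.encard : ℝ≥0∞) := by
  rw [pointMeasure, Measure.sum_apply _ hB, ← ENNReal.tsum_set_one,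
    tsum_subtype {i | x i ∈ B} fun _ => (1 : ℝ≥0∞)]
  refine tsum_congr fun i => ?_
  rw [Measure.dirac_apply' _ hB]
  rfl

lemma pointMeasure_restrict_eq_sum {x : ℕ → S} {T : Set S} (hT : MeasurableSet T)
    (hfin : {i | x i ∈ T}.Finite) :
    (pointMeasure x).restrict T = ∑ i ∈ hfin.toFinset, Measure.dirac (x i) := by
  ext B hB
  rw [Measure.restrict_apply hB, pointMeasure, Measure.sum_apply _ (hB.inter hT),
    Measure.finsetSum_apply, tsum_eq_sum (s := hfin.toFinset)]
  · refine Finset.sum_congr rfl fun i hi => ?_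
    have hiT : x i ∈ T := by simpa using hi
    rw [Measure.dirac_apply' _ (hB.inter hT), Measure.dirac_apply' _ hB]
    by_cases hiB : x i ∈ B <;> simp [hiB, hiT]
  · intro i hi
    have hiT : x i ∉ T := by simpa using hi
    rw [Measure.dirac_apply' _ (hB.inter hT)]
    simp [hiT]

lemma measurable_pointMeasure {x : ℕ → Ω → S} (hx : ∀ i, Measurable (x i)) {B : Set S}
    (hB : MeasurableSet B) : Measurable fun ω => pointMeasure (fun i => x i ω) B := by
  simp only [pointMeasure, Measure.sum_apply _ hB, Measure.dirac_apply' _ hB]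
  exact Measurable.tsum fun i => (measurable_const.indicator hB).comp (hx i)

namespace IsPoissonProcess

variable {x : ℕ → Ω → S} {B : Set S}

lemma hasLaw_count (hx : IsPoissonProcess P x Λ) (hB : MeasurableSet B) (hΛ : Λ B < ∞) :
    HasLaw (fun ω => pointMeasure (fun i => x i ω) B)
      ((poissonMeasure (Λ B).toNNReal).map (fun k : ℕ => (k : ℝ≥0∞))) P where
  aemeasurable := (measurable_pointMeasure hx.measurable hB).aemeasurable
  map_eq := hx.count_law B hB hΛ

lemma ae_finite (hx : IsPoissonProcess P x Λ) (hB : MeasurableSet B) (hΛ : Λ B < ∞) :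
    ∀ᵐ ω ∂P, {i | x i ω ∈ B}.Finite := by
  have hlt : ∀ᵐ ω ∂P, pointMeasure (fun i => x i ω) B < ∞ := by
    rw [(hx.hasLaw_count hB hΛ).ae_iff (p := fun z => z < ∞) (by fun_prop),
      ae_map_iff (by fun_prop) measurableSet_Iio]
    exact ae_of_all _ ENNReal.natCast_lt_top
  filter_upwards [hlt] with ω hω
  rw [pointMeasure_apply hB] at hω
  exact Set.encard_lt_top_iff.1 (mod_cast hω)

lemma measure_forall_notMem (hx : IsPoissonProcess P x Λ) (hB : MeasurableSet B)
    (hΛ : Λ B < ∞) : P {ω | ∀ i, x i ω ∉ B} = ENNReal.ofReal (Real.exp (-Λ.real B)) := by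
  have hvoid : {ω | ∀ i, x i ω ∉ B} = {ω | pointMeasure (fun i => x i ω) B = 0} := by
    ext ω
    simp [pointMeasure_apply hB, Set.eq_empty_iff_forall_notMem]
  have hzero : (fun k : ℕ => (k : ℝ≥0∞)) ⁻¹' {z | z = 0} = {0} := by
    ext k
    simp
  rw [hvoid, (hx.hasLaw_count hB hΛ).measure_eq (p := fun z => z = 0) (measurableSet_singleton _),
    Measure.map_apply (by fun_prop) (measurableSet_eq), hzero, poissonMeasure_singleton]
  simp [measureReal_def, ENNReal.coe_toNNReal_eq_toReal]

lemma ae_exists_mem (hx : IsPoissonProcess P x Λ) {B : ℕ → Set S}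
    (hB : ∀ k, MeasurableSet (B k)) (hΛ : ∀ k, Λ (B k) < ∞)
    (hlim : Tendsto (fun k => Λ.real (B k)) atTop atTop) : ∀ᵐ ω ∂P, ∃ k i, x i ω ∈ B k := by
  have hvoid : Tendsto (fun k => ENNReal.ofReal (Real.exp (-Λ.real (B k)))) atTop (𝓝 0) := by
    rw [← ENNReal.ofReal_zero]
    exact ENNReal.tendsto_ofReal (Real.tendsto_exp_neg_atTop_nhds_zero.comp hlim)
  have hnull : P {ω | ¬ ∃ k i, x i ω ∈ B k} ≤ 0 := by
    refine ge_of_tendsto' hvoid fun k => ?_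
    rw [← hx.measure_forall_notMem (hB k) (hΛ k)]
    exact measure_mono fun ω hω i hi => hω ⟨k, i, hi⟩
  exact le_antisymm hnull zero_le

variable [IsProbabilityMeasure P]

lemma ae_forall_notMem (hx : IsPoissonProcess P x Λ) (hΛ : Λ B = 0) :
    ∀ᵐ ω ∂P, ∀ i, x i ω ∉ B := by
  obtain ⟨B', hBB', hB', hΛ'⟩ := exists_measurable_superset_of_null hΛ
  have hm : MeasurableSet {ω | ∀ i, x i ω ∉ B'} := by
    simp only [Set.ofPred_forall]
    exact MeasurableSet.iInter fun i => hx.measurable i hB'.compl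
  have hone : P {ω | ∀ i, x i ω ∉ B'} = 1 := by
    simp [hx.measure_forall_notMem hB' (by simp [hΛ']), measureReal_def, hΛ']
  have hae : ∀ᵐ ω ∂P, ∀ i, x i ω ∉ B' := (prob_compl_eq_zero_iff hm).2 hone
  filter_upwards [hae] with ω hω i hi using hω i (hBB' hi)

lemma ae_forall (hx : IsPoissonProcess P x Λ) {p : S → Prop} (hp : ∀ᵐ z ∂Λ, p z) :
    ∀ᵐ ω ∂P, ∀ i, p (x i ω) := by
  filter_upwards [hx.ae_forall_notMem (B := {z | ¬ p z}) hp] with ω hω i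
  simpa using hω i

end IsPoissonProcess

/-- The superposition of the first `n` of a sequence of point processes. -/
noncomputable def superposition (x : ℕ → ℕ → S) (n : ℕ) : Measure S :=
  ∑ j ∈ Finset.range n, pointMeasure (x j)

/-- The random measures `ν n` have Poisson counts with parameters `n * F A`, as the superpositions
of independent Poisson processes have. No joint law is prescribed. -/
def HasPoissonCounts (P : Measure Ω) (ν : ℕ → Ω → Measure S) (F : Measure S) : Prop :=
  ∀ (n : ℕ) (A : Set S), MeasurableSet A → F A < ∞ →
    HasLaw (fun ω => ν n ω A)
      ((poissonMeasure (n * (F A).toNNReal)).map (fun k : ℕ => (k : ℝ≥0∞))) P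

lemma IsIIDPoisson.hasPoissonCounts [IsProbabilityMeasure P] {x : ℕ → ℕ → Ω → S}
    (hx : IsIIDPoisson P x Λ) :
    HasPoissonCounts P (fun n ω => superposition (fun j i => x j i ω) n) Λ := by
  intro n A hA hΛ
  have hm : ∀ j, Measurable fun ω => pointMeasure (fun i => x j i ω) A := fun j =>
    measurable_pointMeasure (hx.poisson j).measurable hA
  have hindep : iIndepFun (fun j ω => pointMeasure (fun i => x j i ω) A) P :=
    hx.indep.comp (fun _ (ν : Measure S) => ν A) fun _ => Measure.measurable_coe hA
  simp only [superposition, Measure.finsetSum_apply]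
  induction n with
  | zero =>
    simpa [poissonMeasure_zero, Measure.map_dirac' (f := fun k : ℕ => (k : ℝ≥0∞)) (by fun_prop)]
      using (hasLaw_dirac_of_ae_eq (P := P) (X := fun _ => (0 : ℝ≥0∞)) (ae_of_all _ fun _ => rfl))
  | succ n ih =>
    have hind := hindep.indepFun_finsetSum_of_notMem hm (s := Finset.range n) (i := n) (by simp)
    have hsum := IndepFun.hasLaw_add_map_cast_poissonMeasure hind
      (by simpa only [Finset.sum_fn] using ih) ((hx.poisson n).hasLaw_count hA hΛ)
    simpa only [Finset.sum_range_succ, Finset.sum_fn, Pi.add_def, Nat.cast_add, Nat.cast_one,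
      add_mul, one_mul] using hsum

namespace HasPoissonCounts

variable {S' : Type*} [MeasurableSpace S'] {ν : ℕ → Ω → Measure S} {F : Measure S}

lemma map_restrict (hν : HasPoissonCounts P ν F) {T : Set S} (hT : MeasurableSet T) {π : S → S'}
    (hπ : Measurable π) :
    HasPoissonCounts P (fun n ω => ((ν n ω).restrict T).map π) ((F.restrict T).map π) := by
  intro n A hA hF
  have happly : ∀ m : Measure S, ((m.restrict T).map π) A = m (π ⁻¹' A ∩ T) := fun m => by
    rw [Measure.map_apply hπ hA, Measure.restrict_apply (hπ hA)]
  simp only [happly] at hF ⊢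
  exact hν n _ ((hπ hA).inter hT) hF

lemma ae_eq_zero (hν : HasPoissonCounts P ν F) {A : Set S} (hA : MeasurableSet A)
    (hF : F A = 0) : ∀ᵐ ω ∂P, ∀ n, ν n ω A = 0 := by
  refine ae_all_iff.2 fun n => ?_
  have hlaw := hν n A hA (by simp [hF])
  simp only [hF, ENNReal.toNNReal_zero, mul_zero, poissonMeasure_zero] at hlaw
  rw [Measure.map_dirac' (by fun_prop), Nat.cast_zero] at hlaw
  exact hlaw.ae_eq_of_dirac

lemma measureReal_abs_sub_ge_le (hν : HasPoissonCounts P ν F) {A : Set S}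
    (hA : MeasurableSet A) (hF : F A < ∞) (n : ℕ) {θ : ℝ} (hθ0 : 0 ≤ θ) (hθ1 : θ ≤ 1) (a : ℝ) :
    P.real {ω | a ≤ |(ν n ω).real A - n * F.real A|} ≤
      2 * Real.exp (n * F.real A * θ ^ 2 - θ * a) := by
  have hset : MeasurableSet {z : ℝ≥0∞ | a ≤ |z.toReal - n * F.real A|} :=
    measurableSet_le (by fun_prop) (by fun_prop)
  have hpoisson := poissonMeasure_real_abs_sub_ge_le (n * (F A).toNNReal) hθ0 hθ1 a
  simp only [measureReal_def (ν _ _)]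
  rw [(hν n A hA hF).measureReal_eq (p := fun z => a ≤ |z.toReal - n * F.real A|) hset,
    map_measureReal_apply (by fun_prop) hset]
  simpa only [measureReal_def F, Set.preimage_ofPred_eq, ENNReal.toReal_natCast, NNReal.coe_mul,
    NNReal.coe_natCast, ENNReal.coe_toNNReal_eq_toReal] using hpoisson

/-- The parameter of the Chernoff bound is chosen proportional to `η / D`. -/
lemma exists_measureReal_abs_sub_ge_le (hν : HasPoissonCounts P ν F) {η D : ℝ} (hη : 0 < η)
    (hD : 0 < D) : ∃ κ : ℝ, 0 < κ ∧ ∀ (A : Set S), MeasurableSet A → F A < ∞ →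
      ∀ (n : ℕ) (v : ℝ), 0 ≤ v → F.real A ≤ D * v →
        P.real {ω | η * (n * v) ≤ |(ν n ω).real A - n * F.real A|} ≤
          2 * Real.exp (-(κ * (n * v))) := by
  set θ := min 1 (η / (2 * D))
  have hθ0 : 0 < θ := lt_min one_pos (by positivity)
  have hθη : θ * (2 * D) ≤ η := (le_div_iff₀ (by positivity)).1 (min_le_right _ _)
  refine ⟨θ * η / 2, by positivity, fun A hA hF n v hv hle => ?_⟩
  refine (hν.measureReal_abs_sub_ge_le hA hF n hθ0.le (min_le_left _ _) _).trans ?_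
  have hmean : n * F.real A * θ ^ 2 ≤ θ * η / 2 * (n * v) := calc
    n * F.real A * θ ^ 2 ≤ n * (D * v) * θ ^ 2 := by gcongr
    _ = θ * (n * v) / 2 * (θ * (2 * D)) := by ring
    _ ≤ θ * (n * v) / 2 * η := by gcongr
    _ = θ * η / 2 * (n * v) := by ring
  gcongr
  linarith

end HasPoissonCounts

end PointProcess

section Cells

variable {d : ℕ}

/-- The index `(⌊t₁/ρ⌋, …, ⌊t_d/ρ⌋)` of the cell of the grid of mesh `ρ` that contains `t`. -/
noncomputable def cellIndex (ρ : ℝ) (t : E d) : Fin d → ℤ := fun i => ⌊t i / ρ⌋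

/-- The cell with index `z` of the grid of mesh `ρ`, a half-open cube when `ρ > 0`. -/
def cell (ρ : ℝ) (z : Fin d → ℤ) : Set (E d) := cellIndex ρ ⁻¹' {z}

/-- The corner of the cell with index `z` of the grid of mesh `δ`. -/
noncomputable def latticePoint (δ : ℝ) (z : Fin d → ℤ) : E d := WithLp.toLp 2 fun i => δ * z i

lemma measurable_cellIndex (ρ : ℝ) : Measurable (cellIndex (d := d) ρ) :=
  measurable_pi_lambda _ fun _ => Int.measurable_floor.comp (by fun_prop)

lemma measurableSet_cell (ρ : ℝ) (z : Fin d → ℤ) : MeasurableSet (cell ρ z) :=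
  measurable_cellIndex ρ (measurableSet_singleton z)

lemma pairwise_disjoint_cell (ρ : ℝ) :
    Pairwise (Function.onFun Disjoint (cell (d := d) ρ)) := fun _ _ hne =>
  Disjoint.preimage _ (Set.disjoint_singleton.2 hne)

lemma iUnion_cell (ρ : ℝ) : ⋃ z, cell (d := d) ρ z = Set.univ :=
  Set.iUnion_eq_univ_iff.2 fun t => ⟨cellIndex ρ t, rfl⟩

lemma volume_cell {ρ : ℝ} (hρ : 0 < ρ) (z : Fin d → ℤ) :
    volume (cell (d := d) ρ z) = ENNReal.ofReal (ρ ^ d) := by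
  have hcube : cell ρ z = (WithLp.ofLp : E d → Fin d → ℝ) ⁻¹'
      (Set.univ.pi fun i => Set.Ico (ρ * z i) (ρ * z i + ρ)) := by
    ext t
    simp only [cell, cellIndex, Set.mem_preimage, Set.mem_singleton_iff, funext_iff, Set.mem_pi,
      Set.mem_univ, true_implies, Set.mem_Ico, Int.floor_eq_iff, le_div_iff₀ hρ, div_lt_iff₀ hρ,
      add_mul, one_mul, mul_comm ρ]
  rw [hcube, (PiLp.volume_preserving_ofLp (Fin d)).measure_preimage
    (MeasurableSet.univ_pi fun i => measurableSet_Ico).nullMeasurableSet, Real.volume_pi_Ico]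
  simp [ENNReal.ofReal_pow hρ.le]

lemma norm_le_card_mul_of_abs_le {v : E d} {r : ℝ} (hv : ∀ i, |v i| ≤ r) : ‖v‖ ≤ d * r := calc
  ‖v‖ = ‖∑ i, v i • EuclideanSpace.basisFun (Fin d) ℝ i‖ := by
    conv_lhs => rw [← (EuclideanSpace.basisFun (Fin d) ℝ).sum_repr v]
    rfl
  _ ≤ ∑ i, ‖v i • EuclideanSpace.basisFun (Fin d) ℝ i‖ := norm_sum_le _ _
  _ ≤ ∑ _i : Fin d, r := Finset.sum_le_sum fun i _ => by simpa [norm_smul] using hv i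
  _ = d * r := by simp

lemma norm_smul_sub_latticePoint_le {δ h : ℝ} (hδ : 0 < δ) (hh : 0 < h) (s t : E d) :
    ‖h⁻¹ • (s - t) - latticePoint δ (cellIndex (δ * h) s - cellIndex (δ * h) t)‖ ≤ d * δ := by
  refine norm_le_card_mul_of_abs_le fun i => ?_
  have hfract : (h⁻¹ • (s - t) - latticePoint δ (cellIndex (δ * h) s - cellIndex (δ * h) t)) i =
      δ * (Int.fract (s i / (δ * h)) - Int.fract (t i / (δ * h))) := by
    simp only [latticePoint, cellIndex, PiLp.sub_apply, PiLp.smul_apply, smul_eq_mul,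
      Pi.sub_apply, Int.cast_sub, Int.fract]
    field_simp
    ring
  have hle : |Int.fract (s i / (δ * h)) - Int.fract (t i / (δ * h))| ≤ 1 :=
    abs_sub_le_of_nonneg_of_le (Int.fract_nonneg _) (Int.fract_lt_one _).le (Int.fract_nonneg _)
      (Int.fract_lt_one _).le
  rw [hfract, abs_mul, abs_of_pos hδ]
  exact mul_le_of_le_one_right hδ.le hle

lemma norm_sub_latticePoint_le {δ : ℝ} (hδ : 0 < δ) (v : E d) :
    ‖v - latticePoint δ (cellIndex δ v)‖ ≤ d * δ := by
  have hzero : cellIndex δ (0 : E d) = 0 := by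
    ext i
    simp [cellIndex]
  simpa [hzero] using norm_smul_sub_latticePoint_le hδ one_pos v 0

lemma lintegral_comp_cellIndex (ν : Measure (E d)) (ρ : ℝ) (g : (Fin d → ℤ) → ℝ≥0∞) :
    ∫⁻ t, g (cellIndex ρ t) ∂ν = ∑' z, g z * ν (cell ρ z) := by
  rw [← lintegral_map (f := g) .of_discrete (measurable_cellIndex ρ), lintegral_countable']
  simp only [Measure.map_apply (measurable_cellIndex ρ) (measurableSet_singleton _), cell]

lemma lintegral_comp_cellIndex_volume {ρ : ℝ} (hρ : 0 < ρ) (g : (Fin d → ℤ) → ℝ≥0∞) :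
    ∫⁻ t : E d, g (cellIndex ρ t) = (∑' z, g z) * ENNReal.ofReal (ρ ^ d) := by
  simp_rw [lintegral_comp_cellIndex, volume_cell hρ, ENNReal.tsum_mul_right]

lemma integrable_comp_cellIndex (ν : Measure (E d)) [IsFiniteMeasure ν] (ρ : ℝ)
    {g : (Fin d → ℤ) → ℝ} {M : ℝ} (hg : ∀ z, |g z| ≤ M) :
    Integrable (fun t => g (cellIndex ρ t)) ν :=
  .of_bound (Measurable.of_discrete.comp (measurable_cellIndex ρ)).aestronglyMeasurable M
    (ae_of_all _ fun _ => hg _)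

lemma hasSum_integral_comp_cellIndex (ν : Measure (E d)) [IsFiniteMeasure ν] (ρ : ℝ)
    {g : (Fin d → ℤ) → ℝ} {M : ℝ} (hg : ∀ z, |g z| ≤ M) :
    HasSum (fun z => ν.real (cell ρ z) * g z) (∫ t, g (cellIndex ρ t) ∂ν) := by
  have hcell : ∀ z, ∫ t in cell ρ z, g (cellIndex ρ t) ∂ν = ν.real (cell ρ z) * g z := fun z => by
    have hconst : Set.EqOn (fun t : E d => g (cellIndex ρ t)) (fun _ => g z) (cell ρ z) :=
      fun t ht => congrArg g ht
    rw [setIntegral_congr_fun (measurableSet_cell ρ z) hconst, setIntegral_const, smul_eq_mul]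
  have hsum := hasSum_integral_iUnion (measurableSet_cell ρ) (pairwise_disjoint_cell ρ)
    (integrable_comp_cellIndex ν ρ hg).integrableOn
  simpa only [hcell, iUnion_cell, setIntegral_univ] using hsum

lemma abs_integral_comp_cellIndex_sub_le {ν₁ ν₂ : Measure (E d)} [IsFiniteMeasure ν₁]
    [IsFiniteMeasure ν₂] {ρ a : ℝ} (ha : ∀ z, |ν₁.real (cell ρ z) - ν₂.real (cell ρ z)| ≤ a)
    {g : (Fin d → ℤ) → ℝ} (hg : Summable fun z => |g z|) :
    |∫ t, g (cellIndex ρ t) ∂ν₁ - ∫ t, g (cellIndex ρ t) ∂ν₂| ≤ a * ∑' z, |g z| := by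
  have hbound : ∀ z, |g z| ≤ ∑' w, |g w| := fun z => hg.le_tsum z fun w _ => abs_nonneg (g w)
  have hdiff := (hasSum_integral_comp_cellIndex ν₁ ρ hbound).sub
    (hasSum_integral_comp_cellIndex ν₂ ρ hbound)
  rw [← hdiff.tsum_eq, ← Real.norm_eq_abs, ← tsum_mul_left]
  refine tsum_of_norm_bounded (hg.mul_left a).hasSum fun z => ?_
  rw [← sub_mul, norm_mul]
  exact mul_le_mul_of_nonneg_right (ha z) (abs_nonneg _)

/-- A bound for the oscillation of `k` around the lattice point with index `w`. The radius `d * δ`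
exceeds the diameter of a cell, so that it covers the displacement caused by replacing two points
by the corners of their cells. -/
noncomputable def cellOsc (k : E d → ℝ) (δ : ℝ) (w : Fin d → ℤ) : ℝ≥0∞ :=
  ⨆ u ∈ Metric.closedBall (latticePoint δ w) (d * δ), ‖k u - k (latticePoint δ w)‖ₑ

lemma enorm_sub_le_cellOsc (k : E d → ℝ) {δ : ℝ} {w : Fin d → ℤ} {u : E d}
    (hu : ‖u - latticePoint δ w‖ ≤ d * δ) : ‖k u - k (latticePoint δ w)‖ₑ ≤ cellOsc k δ w :=
  le_iSup₂_of_le u (mem_closedBall_iff_norm.2 hu) le_rfl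

lemma lintegral_cellOsc_sub_cellIndex_le (k : E d → ℝ) (δ ρ : ℝ) {ν : Measure (E d)} {β : ℝ≥0∞}
    (hβ : ∀ z, ν (cell ρ z) ≤ β) (z₀ : Fin d → ℤ) :
    ∫⁻ t, cellOsc k δ (z₀ - cellIndex ρ t) ∂ν ≤ (∑' w, cellOsc k δ w) * β := calc
  _ = ∑' z, cellOsc k δ (z₀ - z) * ν (cell ρ z) :=
    lintegral_comp_cellIndex ν ρ fun z => cellOsc k δ (z₀ - z)
  _ ≤ ∑' z, cellOsc k δ (z₀ - z) * β := by gcongr with z; exact hβ z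
  _ = (∑' w, cellOsc k δ w) * β := by
    rw [ENNReal.tsum_mul_right, ← (Equiv.subLeft z₀).tsum_eq (cellOsc k δ)]
    rfl

lemma abs_integral_sub_integral_latticePoint_le {k : E d → ℝ} (hkm : Measurable k) {M : ℝ}
    (hkb : ∀ v, |k v| ≤ M) {δ h : ℝ} (hδ : 0 < δ) (hh : 0 < h) (ν : Measure (E d))
    [IsFiniteMeasure ν] {A β : ℝ} (hA : ∑' w, cellOsc k δ w ≤ ENNReal.ofReal A) (hA0 : 0 ≤ A)
    (hβ0 : 0 ≤ β) (hβ : ∀ z, ν.real (cell (δ * h) z) ≤ β) (s : E d) :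
    |∫ t, k (h⁻¹ • (s - t)) ∂ν -
        ∫ t, k (latticePoint δ (cellIndex (δ * h) s - cellIndex (δ * h) t)) ∂ν| ≤ A * β := by
  have hint : Integrable (fun t => k (h⁻¹ • (s - t))) ν :=
    .of_bound (hkm.comp (by fun_prop)).aestronglyMeasurable M (ae_of_all _ fun t => hkb _)
  have hint_lattice := integrable_comp_cellIndex ν (δ * h)
    (g := fun z => k (latticePoint δ (cellIndex (δ * h) s - z))) fun z => hkb _
  have hmass : ∀ z, ν (cell (δ * h) z) ≤ ENNReal.ofReal β := fun z =>
    (ENNReal.le_ofReal_iff_toReal_le (measure_ne_top _ _) hβ0).2 (hβ z)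
  rw [← integral_sub hint hint_lattice, ← Real.norm_eq_abs,
    ← ENNReal.ofReal_le_ofReal_iff (mul_nonneg hA0 hβ0), ofReal_norm, ENNReal.ofReal_mul hA0]
  calc _ ≤ ∫⁻ t, ‖k (h⁻¹ • (s - t)) -
          k (latticePoint δ (cellIndex (δ * h) s - cellIndex (δ * h) t))‖ₑ ∂ν :=
        enorm_integral_le_lintegral_enorm _
    _ ≤ ∫⁻ t, cellOsc k δ (cellIndex (δ * h) s - cellIndex (δ * h) t) ∂ν :=
        lintegral_mono fun t =>
          enorm_sub_le_cellOsc k (norm_smul_sub_latticePoint_le hδ hh s t)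
    _ ≤ (∑' w, cellOsc k δ w) * ENNReal.ofReal β :=
        lintegral_cellOsc_sub_cellIndex_le k δ _ hmass _
    _ ≤ ENNReal.ofReal A * ENNReal.ofReal β := by gcongr

lemma abs_integral_smul_sub_le_of_cell {k : E d → ℝ} (hkm : Measurable k) {M : ℝ}
    (hkb : ∀ v, |k v| ≤ M) {δ h : ℝ} (hδ : 0 < δ) (hh : 0 < h) {ν₁ ν₂ : Measure (E d)}
    [IsFiniteMeasure ν₁] [IsFiniteMeasure ν₂] {A a β : ℝ}
    (hA : ∑' w, cellOsc k δ w ≤ ENNReal.ofReal A) (hA0 : 0 ≤ A)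
    (hsum : Summable fun w => |k (latticePoint δ w)|) (ha0 : 0 ≤ a)
    (ha : ∀ z, |ν₁.real (cell (δ * h) z) - ν₂.real (cell (δ * h) z)| ≤ a) (hβ0 : 0 ≤ β)
    (hβ : ∀ z, ν₂.real (cell (δ * h) z) ≤ β) (s : E d) :
    |∫ t, k (h⁻¹ • (s - t)) ∂ν₁ - ∫ t, k (h⁻¹ • (s - t)) ∂ν₂| ≤
      a * (A + ∑' w, |k (latticePoint δ w)|) + 2 * A * β := by
  set z₀ := cellIndex (δ * h) s
  have hdiscr₁ := abs_integral_sub_integral_latticePoint_le hkm hkb hδ hh ν₁ hA hA0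
    (add_nonneg ha0 hβ0) (fun z => by linarith [hβ z, (abs_le.1 (ha z)).2]) s
  have hdiscr₂ := abs_integral_sub_integral_latticePoint_le hkm hkb hδ hh ν₂ hA hA0 hβ0 hβ s
  have hlattice := abs_integral_comp_cellIndex_sub_le ha
    (g := fun z => k (latticePoint δ (z₀ - z))) ((Equiv.subLeft z₀).summable_iff.2 hsum)
  have hshift : ∑' z, |k (latticePoint δ (z₀ - z))| = ∑' w, |k (latticePoint δ w)| :=
    (Equiv.subLeft z₀).tsum_eq fun w => |k (latticePoint δ w)|
  rw [hshift] at hlattice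
  rw [abs_le] at *
  constructor <;> linarith [hdiscr₁.1, hdiscr₁.2, hdiscr₂.1, hdiscr₂.2, hlattice.1, hlattice.2]

end Cells

section SmoothingKernel

variable {d : ℕ} {k : E d → ℝ}

namespace IsSmoothingKernel

lemma exists_bound (hk : IsSmoothingKernel k) : ∃ M, ∀ v, |k v| ≤ M := by
  obtain ⟨L, hL, hkL, -⟩ := hk.dominated
  exact ⟨L 0, fun v => (hkL v).trans (hL Set.self_mem_Ici (norm_nonneg v) (norm_nonneg v))⟩

lemma integrable (hk : IsSmoothingKernel k) : Integrable k :=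
  not_imp_comm.1 integral_undef (hk.integral_eq_one.trans_ne one_ne_zero)

/-- Outside the ball of radius `2 * r`, points at distance at most `r` from `v` have at least half
the norm of `v`. -/
lemma exists_integrable_envelope (hk : IsSmoothingKernel k) (r : ℝ) :
    ∃ D : E d → ℝ, Integrable D ∧ ∀ u v, ‖u - v‖ ≤ r → |k u| ≤ D v := by
  obtain ⟨L, hL, hkL, hLi⟩ := hk.dominated
  have hL0 : ∀ v : E d, 0 ≤ L ‖v‖ := fun v => (abs_nonneg _).trans (hkL v)
  refine ⟨fun v => L ‖(2 : ℝ)⁻¹ • v‖ + (Metric.closedBall 0 (2 * r)).indicator (fun _ => L 0) v,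
    (hLi.comp_smul (by norm_num)).add ?_, fun u v huv => (hkL u).trans ?_⟩
  · exact (integrable_indicator_iff Metric.isClosed_closedBall.measurableSet).2
      (integrableOn_const (isCompact_closedBall _ _).measure_lt_top.ne)
  · dsimp only
    by_cases hv : v ∈ Metric.closedBall (0 : E d) (2 * r)
    · rw [Set.indicator_of_mem hv]
      exact (hL Set.self_mem_Ici (norm_nonneg u) (norm_nonneg u)).trans
        (le_add_of_nonneg_left (hL0 _))
    · rw [Set.indicator_of_notMem hv, add_zero]
      refine hL (norm_nonneg _) (norm_nonneg _) ?_
      rw [mem_closedBall_zero_iff, not_le] at hv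
      rw [norm_smul, Real.norm_of_nonneg (by norm_num)]
      linarith [norm_sub_norm_le v u, norm_sub_rev v u]

end IsSmoothingKernel

lemma cellOsc_cellIndex_le {δ : ℝ} (hδ : 0 < δ) {v : E d} {a c : ℝ}
    (hc : ∀ u, ‖u - v‖ ≤ 2 * d * δ → |k u - a| ≤ c) :
    cellOsc k δ (cellIndex δ v) ≤ ENNReal.ofReal (2 * c) := by
  set w := latticePoint δ (cellIndex δ v)
  have hwv : ‖w - v‖ ≤ d * δ := by
    rw [norm_sub_rev]
    exact norm_sub_latticePoint_le hδ v
  refine iSup₂_le fun u hu => ?_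
  rw [mem_closedBall_iff_norm] at hu
  have hkw : |k w - a| ≤ c := hc w (by linarith [norm_nonneg (w - v)])
  have hku : |k u - a| ≤ c := hc u (by linarith [norm_sub_le_norm_sub_add_norm_sub u w v])
  rw [← ofReal_norm, Real.norm_eq_abs]
  refine ENNReal.ofReal_le_ofReal ?_
  linarith [abs_sub_le (k u) a (k w), abs_sub_comm a (k w)]

lemma tendsto_cellOsc_of_continuousAt {v : E d} (hv : ContinuousAt k v) :
    Tendsto (fun δ => cellOsc k δ (cellIndex δ v)) (𝓝[>] 0) (𝓝 0) := by
  refine ENNReal.tendsto_nhds_zero.2 fun ε hε => ?_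
  rcases eq_or_ne ε ∞ with rfl | hε_top
  · simp
  obtain ⟨η, hη, hηk⟩ := Metric.continuousAt_iff.1 hv (ε.toReal / 2)
    (half_pos (ENNReal.toReal_pos hε.ne' hε_top))
  have hradius : Tendsto (fun δ : ℝ => 2 * d * δ) (𝓝[>] 0) (𝓝 0) :=
    (Continuous.tendsto' (by fun_prop) 0 0 (by simp)).mono_left nhdsWithin_le_nhds
  filter_upwards [hradius.eventually_lt_const hη, self_mem_nhdsWithin] with δ hδη hδ
  refine (cellOsc_cellIndex_le hδ (a := k v) fun u hu => (hηk ?_).le).trans ?_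
  · exact (dist_eq_norm u v).trans_lt (hu.trans_lt hδη)
  · rw [mul_div_cancel₀ _ two_ne_zero, ENNReal.ofReal_toReal hε_top]

namespace IsSmoothingKernel

/-- A dominated, almost everywhere continuous kernel is directly Riemann integrable. -/
lemma tendsto_tsum_cellOsc (hk : IsSmoothingKernel k) :
    Tendsto (fun δ => (∑' w, cellOsc k δ w) * ENNReal.ofReal (δ ^ d)) (𝓝[>] 0) (𝓝 0) := by
  obtain ⟨D, hDi, hD⟩ := hk.exists_integrable_envelope (2 * d)
  have hlim : Tendsto (fun δ => ∫⁻ v, cellOsc k δ (cellIndex δ v)) (𝓝[>] 0) (𝓝 0) := by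
    rw [← lintegral_zero (μ := (volume : Measure (E d)))]
    refine tendsto_lintegral_filter_of_dominated_convergence (fun v => ENNReal.ofReal (2 * D v))
      (.of_forall fun δ =>
        (Measurable.of_discrete (f := cellOsc k δ)).comp (measurable_cellIndex δ)) ?_
      (hDi.const_mul 2).lintegral_lt_top.ne
      (hk.ae_continuousAt.mono fun v hv => tendsto_cellOsc_of_continuousAt hv)
    filter_upwards [Ioc_mem_nhdsGT (one_pos : (0 : ℝ) < 1)] with δ hδ
    refine ae_of_all _ fun v => cellOsc_cellIndex_le hδ.1 (a := 0) fun u hu => ?_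
    rw [sub_zero]
    exact hD u v (hu.trans (mul_le_of_le_one_right (by positivity) hδ.2))
  refine hlim.congr' ?_
  filter_upwards [self_mem_nhdsWithin] with δ hδ using lintegral_comp_cellIndex_volume hδ _

lemma summable_latticePoint (hk : IsSmoothingKernel k) {δ : ℝ} (hδ : 0 < δ) :
    Summable fun w => |k (latticePoint δ w)| := by
  obtain ⟨D, hDi, hD⟩ := hk.exists_integrable_envelope (d * δ)
  have hsum : (∑' w, ‖k (latticePoint δ w)‖ₑ) * ENNReal.ofReal (δ ^ d) < ∞ := by
    rw [← lintegral_comp_cellIndex_volume hδ fun w => ‖k (latticePoint δ w)‖ₑ]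
    refine (lintegral_mono fun v => ?_).trans_lt hDi.lintegral_lt_top
    rw [← ofReal_norm, Real.norm_eq_abs]
    refine ENNReal.ofReal_le_ofReal (hD _ v ?_)
    rw [norm_sub_rev]
    exact norm_sub_latticePoint_le hδ v
  have hfin := ENNReal.lt_top_of_mul_ne_top_left hsum.ne (by simpa using pow_pos hδ d)
  simpa using ENNReal.summable_toReal hfin.ne

end IsSmoothingKernel

section Mollification

lemma tendstoUniformly_iff_tendsto_sub {ι α : Type*} {F : ι → α → ℝ} {f : α → ℝ}
    {l : Filter ι} :
    TendstoUniformly F f l ↔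
      Tendsto (fun q : ι × α => F q.1 q.2 - f q.2) (l ×ˢ ⊤) (𝓝 0) := by
  rw [tendstoUniformly_iff_tendsto, uniformity_eq_comap_nhds_zero, tendsto_comap_iff]
  rfl

variable {V : Type*} [NormedAddCommGroup V] [NormedSpace ℝ V] {f : V → ℝ}

lemma tendstoUniformly_comp_sub_smul (hf : UniformContinuous f) (v : V) :
    TendstoUniformly (fun (h : ℝ) s => f (s - h • v)) f (𝓝 0) := by
  refine hf.comp_tendstoUniformly (f := id) (F := fun (h : ℝ) s => s - h • v)
    (Metric.tendstoUniformly_iff.2 fun ε hε => ?_)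
  have hnorm : Tendsto (fun h : ℝ => ‖h • v‖) (𝓝 0) (𝓝 0) :=
    Continuous.tendsto' (by fun_prop) 0 0 (by simp)
  filter_upwards [hnorm.eventually_lt_const hε] with h hh s
  simpa [dist_eq_norm] using hh

lemma tendstoUniformly_integral_mul_comp_sub_smul [MeasurableSpace V] [OpensMeasurableSpace V]
    {μ : Measure V} {k : V → ℝ} (hk : Integrable k μ) (hk1 : ∫ v, k v ∂μ = 1)
    (hf : UniformContinuous f) {M : ℝ} (hM : ∀ v, |f v| ≤ M) :
    TendstoUniformly (fun (h : ℝ) s => ∫ v, k v * f (s - h • v) ∂μ) f (𝓝 0) := by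
  have hcont : ∀ q : ℝ × V, Continuous fun v => f (q.2 - q.1 • v) := fun q =>
    hf.continuous.comp (by fun_prop)
  have hdiff : ∀ q : ℝ × V, (∫ v, k v * f (q.2 - q.1 • v) ∂μ) - f q.2 =
      ∫ v, k v * (f (q.2 - q.1 • v) - f q.2) ∂μ := fun q => by
    have hint : Integrable (fun v => k v * f (q.2 - q.1 • v)) μ :=
      hk.mul_bdd (c := M) (hcont q).aestronglyMeasurable (ae_of_all _ fun v => hM _)
    simp_rw [mul_sub]
    rw [integral_sub hint (hk.mul_const _), integral_mul_const, hk1, one_mul]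
  have hlim : Tendsto (fun q : ℝ × V => ∫ v, k v * (f (q.2 - q.1 • v) - f q.2) ∂μ)
      (𝓝 0 ×ˢ ⊤) (𝓝 (∫ _, 0 ∂μ)) := by
    refine tendsto_integral_filter_of_dominated_convergence (fun v => |k v| * (M + M))
      (.of_forall fun q => ?_) (.of_forall fun q => ae_of_all _ fun v => ?_)
      (hk.abs.mul_const _) (ae_of_all _ fun v => ?_)
    · exact hk.aestronglyMeasurable.mul ((hcont q).sub continuous_const).aestronglyMeasurable
    · rw [norm_mul, Real.norm_eq_abs]
      gcongr
      exact (norm_sub_le _ _).trans (add_le_add (hM _) (hM _))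
    · simpa using (tendstoUniformly_iff_tendsto_sub.1
        (tendstoUniformly_comp_sub_smul hf v)).const_mul (k v)
  rw [tendstoUniformly_iff_tendsto_sub]
  simpa only [hdiff, integral_zero] using hlim

end Mollification

lemma integral_comp_smul_sub_withDensity {f : E d → ℝ} (hf : Measurable f) (hf0 : ∀ v, 0 ≤ f v)
    {h : ℝ} (hh : 0 < h) (s : E d) :
    ∫ t, k (h⁻¹ • (s - t)) ∂(volume.withDensity fun t => ENNReal.ofReal (f t)) =
      h ^ d * ∫ v, k v * f (s - h • v) := by
  have hweight : ∀ t, (ENNReal.ofReal (f t)).toReal • k (h⁻¹ • (s - t)) =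
      (fun u => f (s - u) * k (h⁻¹ • u)) (s - t) := fun t => by
    simp [ENNReal.toReal_ofReal (hf0 t)]
  have hscale : ∀ u, f (s - u) * k (h⁻¹ • u) = (fun v => k v * f (s - h • v)) (h⁻¹ • u) :=
    fun u => by simp [smul_smul, hh.ne', mul_comm]
  rw [integral_withDensity_eq_integral_toReal_smul (by fun_prop) (by simp)]
  simp_rw [hweight]
  rw [integral_sub_left_eq_self (fun u => f (s - u) * k (h⁻¹ • u)) volume s]
  simp_rw [hscale]
  rw [Measure.integral_comp_inv_smul_of_nonneg _ (fun v => k v * f (s - h • v)) hh.le]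
  simp

end SmoothingKernel

section UniformConvergence

variable {d : ℕ} {k f : E d → ℝ}

lemma IsSmoothingKernel.exists_mesh (hk : IsSmoothingKernel k) {ε : ℝ} (hε : 0 < ε) :
    ∃ (p : ℕ) (A : ℝ), 0 ≤ A ∧ ∑' w, cellOsc k (1 / (p + 1)) w ≤ ENNReal.ofReal A ∧
      A * (1 / (p + 1)) ^ d ≤ ε := by
  have hmesh : Tendsto (fun p : ℕ => 1 / ((p : ℝ) + 1)) atTop (𝓝[>] 0) :=
    tendsto_nhdsWithin_iff.2 ⟨tendsto_one_div_add_atTop_nhds_zero_nat,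
      .of_forall fun p => Set.mem_Ioi.2 Nat.one_div_pos_of_nat⟩
  obtain ⟨p, hp⟩ := ((hk.tendsto_tsum_cellOsc.comp hmesh).eventually_lt_const
    (ENNReal.ofReal_pos.2 hε)).exists
  have hδ : (0 : ℝ) < 1 / (p + 1) := Nat.one_div_pos_of_nat
  have hfin := ENNReal.lt_top_of_mul_ne_top_left hp.ne_top (by simpa using pow_pos hδ d)
  refine ⟨p, _, ENNReal.toReal_nonneg, (ENNReal.ofReal_toReal hfin.ne).ge, ?_⟩
  rw [Function.comp_apply, ← ENNReal.ofReal_toReal hfin.ne,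
    ← ENNReal.ofReal_mul ENNReal.toReal_nonneg] at hp
  exact ((ENNReal.ofReal_lt_ofReal_iff hε).1 hp).le

/-- Along `l`, the measures `ν i` and `F` have nearly the same mass in every cell of the grids whose
mesh is a fixed multiple of `H i`, uniformly over the cells. The multiples `1 / (p + 1)` suffice and
keep the condition countable. -/
def CellwiseClose {ι : Type*} (ν : ι → Measure (E d)) (F : Measure (E d)) (H : ι → ℝ)
    (l : Filter ι) : Prop :=
  ∀ p : ℕ, ∀ η > 0, ∀ᶠ i in l, ∀ z,
    |(ν i).real (cell (1 / (p + 1) * H i) z) - F.real (cell (1 / (p + 1) * H i) z)| ≤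
      η * H i ^ d

lemma measureReal_withDensity_cell_le {M : ℝ} (hM0 : 0 ≤ M) (hM : ∀ v, f v ≤ M) {ρ : ℝ}
    (hρ : 0 < ρ) (z : Fin d → ℤ) :
    (volume.withDensity fun t => ENNReal.ofReal (f t)).real (cell ρ z) ≤ M * ρ ^ d := by
  refine ENNReal.toReal_le_of_le_ofReal (by positivity) ?_
  rw [withDensity_apply _ (measurableSet_cell _ _), ENNReal.ofReal_mul hM0,
    ← volume_cell hρ z, ← setLIntegral_const]
  exact lintegral_mono fun t => ENNReal.ofReal_le_ofReal (hM t)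

variable {M : ℝ}

lemma IsSmoothingKernel.abs_inv_mul_integral_sub_le (hk : IsSmoothingKernel k)
    (hf : Measurable f) (hf0 : ∀ v, 0 ≤ f v) (hM : ∀ v, f v ≤ M) (hfi : Integrable f) {δ h : ℝ}
    (hδ : 0 < δ) (hh : 0 < h) {A : ℝ} (hA0 : 0 ≤ A)
    (hA : ∑' w, cellOsc k δ w ≤ ENNReal.ofReal A) {ν : Measure (E d)} [IsFiniteMeasure ν] {η : ℝ}
    (hη : 0 ≤ η)
    (hν : ∀ z, |ν.real (cell (δ * h) z) - (volume.withDensity fun t => ENNReal.ofReal (f t)).real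
      (cell (δ * h) z)| ≤ η * h ^ d) (s : E d) :
    |(h ^ d)⁻¹ * ∫ t, k (h⁻¹ • (s - t)) ∂ν - ∫ v, k v * f (s - h • v)| ≤
      η * (A + ∑' w, |k (latticePoint δ w)|) + 2 * M * (A * δ ^ d) := by
  have : IsFiniteMeasure (volume.withDensity fun t => ENNReal.ofReal (f t)) :=
    isFiniteMeasure_withDensity_ofReal hfi.2
  have hM0 : 0 ≤ M := (hf0 0).trans (hM 0)
  have hhd : 0 < h ^ d := pow_pos hh d
  obtain ⟨L, hL⟩ := hk.exists_bound
  have hsmooth := abs_integral_smul_sub_le_of_cell hk.measurable hL hδ hh hA hA0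
    (hk.summable_latticePoint hδ) (by positivity) hν (by positivity)
    (measureReal_withDensity_cell_le hM0 hM (mul_pos hδ hh)) s
  rw [integral_comp_smul_sub_withDensity hf hf0 hh] at hsmooth
  have hfactor : ∀ J I : ℝ, (h ^ d)⁻¹ * J - I = (h ^ d)⁻¹ * (J - h ^ d * I) := fun J I => by
    field_simp
  rw [hfactor, abs_mul, abs_of_pos (inv_pos.2 hhd), inv_mul_le_iff₀ hhd]
  refine hsmooth.trans_eq ?_
  rw [mul_pow]
  ring

variable {ι : Type*} {ν : ι → Measure (E d)} [∀ i, IsFiniteMeasure (ν i)] {H : ι → ℝ}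
  {l : Filter ι}

lemma CellwiseClose.eventually_abs_inv_mul_integral_sub_le
    (hν : CellwiseClose ν (volume.withDensity fun t => ENNReal.ofReal (f t)) H l)
    (hk : IsSmoothingKernel k) (hf : Measurable f) (hf0 : ∀ v, 0 ≤ f v) (hM : ∀ v, f v ≤ M)
    (hfi : Integrable f) (hH : ∀ i, 0 < H i) {ε : ℝ} (hε : 0 < ε) :
    ∀ᶠ i in l, ∀ s, |(H i ^ d)⁻¹ * ∫ t, k ((H i)⁻¹ • (s - t)) ∂(ν i) -
      ∫ v, k v * f (s - H i • v)| ≤ ε := by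
  have hM0 : 0 ≤ M := (hf0 0).trans (hM 0)
  obtain ⟨p, A, hA0, hA, hAε⟩ := hk.exists_mesh (ε := ε / (4 * (M + 1))) (by positivity)
  set B := A + ∑' w : Fin d → ℤ, |k (latticePoint (1 / (p + 1)) w)|
  have hB0 : 0 ≤ B := add_nonneg hA0 (tsum_nonneg fun _ => abs_nonneg _)
  filter_upwards [hν p (ε / (2 * (B + 1))) (by positivity)] with i hi s
  refine (hk.abs_inv_mul_integral_sub_le hf hf0 hM hfi Nat.one_div_pos_of_nat (hH i) hA0 hA
    (by positivity) hi s).trans ?_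
  have hdeviation : ε / (2 * (B + 1)) * B ≤ ε / 2 := by
    rw [div_mul_eq_mul_div, div_le_div_iff₀ (by positivity) two_pos]
    linarith
  have hoscillation : 2 * M * (A * (1 / (p + 1)) ^ d) ≤ ε / 2 := by
    rw [le_div_iff₀ (by positivity)] at hAε
    have : 0 ≤ A * (1 / ((p : ℝ) + 1)) ^ d := by positivity
    linarith
  linarith

theorem CellwiseClose.tendstoUniformly_inv_mul_integral
    (hν : CellwiseClose ν (volume.withDensity fun t => ENNReal.ofReal (f t)) H l)
    (hk : IsSmoothingKernel k) (hf : UniformContinuous f) (hf0 : ∀ v, 0 ≤ f v)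
    (hM : ∀ v, f v ≤ M) (hfi : Integrable f) (hH : ∀ i, 0 < H i) (hH0 : Tendsto H l (𝓝 0)) :
    TendstoUniformly (fun i s => (H i ^ d)⁻¹ * ∫ t, k ((H i)⁻¹ • (s - t)) ∂(ν i)) f l := by
  have hbias := tendstoUniformly_integral_mul_comp_sub_smul hk.integrable hk.integral_eq_one hf
    fun v => (abs_of_nonneg (hf0 v)).trans_le (hM v)
  refine Metric.tendstoUniformly_iff.2 fun ε hε => ?_
  filter_upwards [hH0.eventually (Metric.tendstoUniformly_iff.1 hbias (ε / 2) (half_pos hε)),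
    hν.eventually_abs_inv_mul_integral_sub_le hk hf.continuous.measurable hf0 hM hfi hH
      (half_pos hε)] with i hbias_i hdev_i s
  refine (dist_triangle _ _ _).trans_lt ((add_lt_add_of_lt_of_le (hbias_i s) ?_).trans_eq
    (add_halves ε))
  rw [dist_comm, Real.dist_eq]
  exact hdev_i s

end UniformConvergence

section Storms

variable {d : ℕ} {C R μ : ℝ} {PX : Measure C(E d, ℝ)} {ψ : C(E d, ℝ)} {K : Set (E d)}

/-- The almost sure properties of a storm shape: it takes values in `[0, C]`, vanishes outside of
the closed ball of radius `R` and is positive on the open one. -/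
structure IsShape (C R : ℝ) (X : C(E d, ℝ)) : Prop where
  nonneg : ∀ s, 0 ≤ X s
  le : ∀ s, X s ≤ C
  eq_zero : ∀ s, R < ‖s‖ → X s = 0
  pos : ∀ s, ‖s‖ < R → 0 < X s

lemma ae_isShape (hC : 0 ≤ C) (hnonneg : ∀ᵐ X ∂PX, ∀ s, 0 ≤ X s)
    (hle : ∀ᵐ X ∂PX, ∀ s, X s ≤ C * (Metric.closedBall (0 : E d) R).indicator 1 s)
    (hpos : ∀ᵐ X ∂PX, ∀ s : E d, ‖s‖ < R → 0 < X s) : ∀ᵐ X ∂PX, IsShape C R X := by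
  filter_upwards [hnonneg, hle, hpos] with X hX_nonneg hX_le hX_pos
  refine ⟨hX_nonneg, fun s => (hX_le s).trans (mul_le_of_le_one_right hC ?_),
    fun s hs => le_antisymm ((hX_le s).trans ?_) (hX_nonneg s), hX_pos⟩
  · exact Set.indicator_le_self' (fun _ _ => zero_le_one) s
  · simp [not_le.2 hs]

/-- The measure `u⁻² du` on `(0, ∞)`, the severity factor of `stormIntensity`. -/
noncomputable def severityMeasure : Measure ℝ :=
  (volume.restrict (Set.Ioi (0 : ℝ))).withDensity fun u => ENNReal.ofReal (u ^ 2)⁻¹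

instance : SFinite severityMeasure := by
  unfold severityMeasure
  infer_instance

lemma stormIntensity_eq : stormIntensity μ PX ψ = ENNReal.ofReal μ⁻¹ •
    ((volume.withDensity fun s => ENNReal.ofReal (ψ s)).prod (severityMeasure.prod PX)) := rfl

lemma severityMeasure_Ici {a : ℝ} (ha : 0 < a) :
    severityMeasure (Set.Ici a) = ENNReal.ofReal a⁻¹ := by
  have hsubset : Set.Ici a ∩ Set.Ioi 0 = Set.Ici a :=
    Set.inter_eq_left.2 fun u hu => ha.trans_le hu
  have hrpow : ∀ u ∈ Set.Ioi a, ENNReal.ofReal (u ^ 2)⁻¹ = ENNReal.ofReal (u ^ (-2 : ℝ)) :=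
    fun u hu => by rw [Real.rpow_neg (ha.trans hu).le, Real.rpow_two]
  rw [severityMeasure, withDensity_apply _ measurableSet_Ici,
    Measure.restrict_restrict measurableSet_Ici, hsubset, setLIntegral_congr Ioi_ae_eq_Ici.symm,
    setLIntegral_congr_fun measurableSet_Ioi hrpow,
    ← ofReal_integral_eq_lintegral_ofReal (integrableOn_Ioi_rpow_of_lt (by norm_num) ha),
    integral_Ioi_rpow_of_lt (by norm_num) ha]
  · norm_num [Real.rpow_neg_one]
  · exact (ae_restrict_iff' measurableSet_Ioi).2
      (ae_of_all _ fun u hu => Real.rpow_nonneg (ha.trans hu).le _)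

lemma ae_severityMeasure_pos : ∀ᵐ u ∂severityMeasure, 0 < u :=
  (withDensity_absolutelyContinuous _ _).ae_le (ae_restrict_mem measurableSet_Ioi)

lemma severityMeasure_setOf_inv_le {r : ℝ≥0∞} (hr : r ≠ ∞) :
    severityMeasure {u | (ENNReal.ofReal u)⁻¹ ≤ r} = r := by
  rcases eq_or_ne r 0 with rfl | hr0
  · simp
  have hpos : 0 < r.toReal⁻¹ := inv_pos.2 (ENNReal.toReal_pos hr0 hr)
  have hIci : {u | (ENNReal.ofReal u)⁻¹ ≤ r} = Set.Ici r.toReal⁻¹ := by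
    ext u
    rw [Set.mem_ofPred_eq, Set.mem_Ici, ENNReal.inv_le_iff_inv_le,
      ← ENNReal.ofReal_toReal (ENNReal.inv_ne_top.2 hr0), ENNReal.toReal_inv,
      ENNReal.ofReal_le_ofReal_iff', or_iff_left hpos.not_ge]
  rw [hIci, severityMeasure_Ici hpos, inv_inv, ENNReal.ofReal_toReal hr]

lemma stormIntensity_apply [SFinite PX] {S : Set (Storm d)} (hS : MeasurableSet S) :
    stormIntensity μ PX ψ S = ENNReal.ofReal μ⁻¹ * ∫⁻ s, ENNReal.ofReal (ψ s) *
      ∫⁻ X, severityMeasure {u | (s, u, X) ∈ S} ∂PX := by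
  rw [stormIntensity_eq, Measure.smul_apply, smul_eq_mul, Measure.prod_apply hS,
    lintegral_withDensity_eq_lintegral_mul _ (by fun_prop) (measurable_measure_prodMk_left hS)]
  simp only [Pi.mul_apply, Measure.prod_apply_symm (measurable_prodMk_left hS)]
  rfl

lemma stormIntensity_prod_Ici [IsProbabilityMeasure PX] {A : Set (E d)} (hA : MeasurableSet A)
    {a : ℝ} (ha : 0 < a) :
    stormIntensity μ PX ψ (A ×ˢ (Set.Ici a ×ˢ Set.univ)) =
      ENNReal.ofReal μ⁻¹ * ((∫⁻ s in A, ENNReal.ofReal (ψ s)) * ENNReal.ofReal a⁻¹) := by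
  rw [stormIntensity_eq, Measure.smul_apply, smul_eq_mul, Measure.prod_prod,
    Measure.prod_prod, severityMeasure_Ici ha, measure_univ, mul_one, withDensity_apply _ hA]

lemma ae_stormIntensity (hX : ∀ᵐ X ∂PX, IsShape C R X) :
    ∀ᵐ p ∂(stormIntensity μ PX ψ), 0 < p.2.1 ∧ IsShape C R p.2.2 := by
  have hmarks : ∀ᵐ q ∂(severityMeasure.prod PX), 0 < q.1 ∧ IsShape C R q.2 :=
    (Measure.quasiMeasurePreserving_fst.ae ae_severityMeasure_pos).and
      (Measure.quasiMeasurePreserving_snd.ae hX)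
  rw [stormIntensity_eq]
  exact Measure.ae_smul_measure (Measure.quasiMeasurePreserving_snd.ae hmarks) _

lemma setLIntegral_ofReal_lt_top (ψ : C(E d, ℝ)) {A : Set (E d)} (hA : Bornology.IsBounded A) :
    ∫⁻ s in A, ENNReal.ofReal (ψ s) < ∞ :=
  ((ψ.continuous.continuousOn.integrableOn_compact hA.isCompact_closure).mono_set
    subset_closure).lintegral_lt_top

lemma stormIntensity_prod_Ici_lt_top [IsProbabilityMeasure PX] {A : Set (E d)}
    (hA : MeasurableSet A) (hA_bdd : Bornology.IsBounded A) {a : ℝ} (ha : 0 < a) :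
    stormIntensity μ PX ψ (A ×ˢ (Set.Ici a ×ˢ Set.univ)) < ∞ := by
  rw [stormIntensity_prod_Ici hA ha]
  exact ENNReal.mul_lt_top ENNReal.ofReal_lt_top
    (ENNReal.mul_lt_top (setLIntegral_ofReal_lt_top ψ hA_bdd) ENNReal.ofReal_lt_top)

lemma mem_add_closedBall_zero_iff {s : E d} :
    s ∈ K + Metric.closedBall (0 : E d) R ↔ ∃ t ∈ K, ‖t - s‖ ≤ R := by
  refine ⟨?_, fun ⟨t, ht, hts⟩ => ⟨t, ht, s - t, ?_, add_sub_cancel _ _⟩⟩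
  · rintro ⟨t, ht, v, hv, rfl⟩
    exact ⟨t, ht, by simpa using hv⟩
  · rwa [mem_closedBall_zero_iff, norm_sub_rev]

lemma extremalField_ne_top {x : ℕ → Storm d} {t : E d}
    (hx : ∀ i, IsShape C R (x i).2.2)
    (hfin : {i | ‖t - (x i).1‖ ≤ R ∧ 1 ≤ (x i).2.1}.Finite) : extremalField x t ≠ ∞ := by
  set Y : ℕ → ℝ≥0∞ := fun i => ENNReal.ofReal ((x i).2.1 * (x i).2.2 (t - (x i).1))
  have hbound : ENNReal.ofReal C + ∑ i ∈ hfin.toFinset, Y i ≠ ∞ :=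
    ENNReal.add_ne_top.2 ⟨ENNReal.ofReal_ne_top, ENNReal.sum_ne_top.2 fun _ _ =>
      ENNReal.ofReal_ne_top⟩
  refine ne_top_of_le_ne_top hbound (iSup_le fun i => ?_)
  by_cases hi : i ∈ hfin.toFinset
  · exact (Finset.single_le_sum (f := Y) (fun _ _ => zero_le) hi).trans le_add_self
  · refine le_add_right (ENNReal.ofReal_le_ofReal_iff'.2 ?_)
    rw [Set.Finite.mem_toFinset, Set.mem_ofPred_eq, not_and_or, not_le, not_le] at hi
    rcases hi with hfar | hsmall
    · exact Or.inr (by rw [(hx i).eq_zero _ hfar, mul_zero])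
    · exact Or.inl ((mul_le_of_le_one_left ((hx i).nonneg _) hsmall.le).trans ((hx i).le _))

lemma lowerSemicontinuous_extremalField (x : ℕ → Storm d) :
    LowerSemicontinuous (extremalField x) :=
  lowerSemicontinuous_iSup fun i => Continuous.lowerSemicontinuous <|
    ENNReal.continuous_ofReal.comp (by fun_prop)

lemma exists_le_extremalField {x : ℕ → Storm d} (hK : IsCompact K)
    (hx : ∀ t ∈ K, extremalField x t ≠ 0) : ∃ c ≠ 0, ∀ t ∈ K, c ≤ extremalField x t := by
  rcases K.eq_empty_or_nonempty with hempty | hne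
  · exact ⟨1, one_ne_zero, by simp [hempty]⟩
  · obtain ⟨t, ht, hmin⟩ :=
      ((lowerSemicontinuous_extremalField x).lowerSemicontinuousOn K).exists_isMinOn hne hK
    exact ⟨extremalField x t, hx t ht, isMinOn_iff.1 hmin⟩

lemma extremalField_pos {x : ℕ → Storm d} {t : E d} {i : ℕ} (hu : 0 < (x i).2.1)
    (hX : IsShape C R (x i).2.2) (hi : ‖t - (x i).1‖ < R) : 0 < extremalField x t :=
  (ENNReal.ofReal_pos.2 (mul_pos hu (hX.pos _ hi))).trans_le (le_iSup_of_le i le_rfl)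

namespace IsPoissonProcess

variable [IsProbabilityMeasure PX] {Ω : Type*} [MeasurableSpace Ω] {P : Measure Ω}
  {x : ℕ → Ω → Storm d}

lemma ae_exists_mem_ball (hx : IsPoissonProcess P x (stormIntensity μ PX ψ)) (hμ : 0 < μ)
    (hψ : ∀ s, 0 < ψ s) (a : E d) {r : ℝ} (hr : 0 < r) :
    ∀ᵐ ω ∂P, ∃ i, (x i ω).1 ∈ Metric.ball a r := by
  set B : ℕ → Set (Storm d) := fun n =>
    Metric.ball a r ×ˢ (Set.Ici (1 / ((n : ℝ) + 1)) ×ˢ Set.univ)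
  set J := ∫⁻ s in Metric.ball a r, ENNReal.ofReal (ψ s)
  have hJ : 0 < J.toReal := by
    refine ENNReal.toReal_pos ((setLIntegral_pos_iff (by fun_prop)).2 ?_).ne'
      (setLIntegral_ofReal_lt_top ψ Metric.isBounded_ball).ne
    have hsupport : Function.support (fun s => ENNReal.ofReal (ψ s)) = Set.univ := by
      ext s
      simp [hψ s]
    rw [hsupport, Set.univ_inter]
    exact Metric.measure_ball_pos _ _ hr
  have hmass : ∀ n, (stormIntensity μ PX ψ).real (B n) = μ⁻¹ * J.toReal * (n + 1) := fun n => by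
    rw [measureReal_def, stormIntensity_prod_Ici measurableSet_ball (by positivity), one_div,
      inv_inv, ENNReal.toReal_mul, ENNReal.toReal_mul, ENNReal.toReal_ofReal (by positivity),
      ENNReal.toReal_ofReal (by positivity), mul_assoc]
  have hlim : Tendsto (fun n => (stormIntensity μ PX ψ).real (B n)) atTop atTop := by
    simp_rw [hmass]
    exact (tendsto_atTop_add_const_right _ _ tendsto_natCast_atTop_atTop).const_mul_atTop
      (by positivity)
  filter_upwards [hx.ae_exists_mem
    (fun n => measurableSet_ball.prod (measurableSet_Ici.prod .univ))
    (fun n => stormIntensity_prod_Ici_lt_top measurableSet_ball Metric.isBounded_ball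
      (by positivity)) hlim] with ω ⟨n, i, hi⟩ using ⟨i, hi.1⟩

lemma ae_forall_exists_dist_lt (hx : IsPoissonProcess P x (stormIntensity μ PX ψ)) (hμ : 0 < μ)
    (hψ : ∀ s, 0 < ψ s) {r : ℝ} (hr : 0 < r) : ∀ᵐ ω ∂P, ∀ t, ∃ i, dist t (x i ω).1 < r := by
  filter_upwards [ae_all_iff.2 fun n => hx.ae_exists_mem_ball hμ hψ (TopologicalSpace.denseSeq _ n)
    (half_pos hr)] with ω hω t
  obtain ⟨n, hn⟩ := Metric.denseRange_iff.1 (TopologicalSpace.denseRange_denseSeq (E d)) t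
    (r / 2) (half_pos hr)
  obtain ⟨i, hi⟩ := hω n
  exact ⟨i, (dist_triangle_right _ _ _).trans_lt ((add_lt_add hn hi).trans_eq (add_halves r))⟩

variable [IsProbabilityMeasure P]

lemma ae_extremalField_ne_top (hx : IsPoissonProcess P x (stormIntensity μ PX ψ))
    (hX : ∀ᵐ X ∂PX, IsShape C R X) (hK : IsCompact K) :
    ∀ᵐ ω ∂P, ∀ t ∈ K, extremalField (fun i => x i ω) t ≠ ∞ := by
  set A := K + Metric.closedBall (0 : E d) R
  have hA : IsCompact A := hK.add (isCompact_closedBall _ _)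
  filter_upwards [hx.ae_finite (hA.measurableSet.prod (measurableSet_Ici.prod .univ))
    (stormIntensity_prod_Ici_lt_top hA.measurableSet hA.isBounded one_pos),
    hx.ae_forall (ae_stormIntensity hX)] with ω hfin hshape t ht
  refine extremalField_ne_top (fun i => (hshape i).2) (hfin.subset fun i ⟨hnear, hlarge⟩ => ?_)
  exact Set.mk_mem_prod (mem_add_closedBall_zero_iff.2 ⟨t, ht, hnear⟩)
    (Set.mk_mem_prod hlarge (Set.mem_univ _))

lemma ae_exists_le_extremalField (hx : IsPoissonProcess P x (stormIntensity μ PX ψ)) (hμ : 0 < μ)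
    (hR : 0 < R) (hψ : ∀ s, 0 < ψ s) (hX : ∀ᵐ X ∂PX, IsShape C R X) (hK : IsCompact K) :
    ∀ᵐ ω ∂P, ∃ c ≠ 0, ∀ t ∈ K, c ≤ extremalField (fun i => x i ω) t := by
  filter_upwards [hx.ae_forall_exists_dist_lt hμ hψ hR, hx.ae_forall (ae_stormIntensity hX)]
    with ω hnear hshape
  refine exists_le_extremalField hK fun t _ => ?_
  obtain ⟨i, hi⟩ := hnear t
  rw [dist_eq_norm] at hi
  have hpos := extremalField_pos (x := fun i => x i ω) (hshape i).1 (hshape i).2 hi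
  exact hpos.ne'

end IsPoissonProcess

end Storms

section Retention

variable {d : ℕ} {C R μ : ℝ} {c : ℝ≥0∞} {PX : Measure C(E d, ℝ)} {ψ : C(E d, ℝ)} {K : Set (E d)}
  {y : E d → ℝ≥0∞} {X : C(E d, ℝ)}

lemma measurable_supRatio (hy : ∀ t ∈ K, y t ≠ 0) :
    Measurable (Function.uncurry (supRatio K y)) := by
  refine (lowerSemicontinuous_biSup fun t ht => Continuous.lowerSemicontinuous ?_).measurable
  have heval : Continuous fun p : E d × C(E d, ℝ) => p.2 (t - p.1) := by fun_prop
  exact (ENNReal.continuous_div_const _ (hy t ht)).comp (ENNReal.continuous_ofReal.comp heval)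

lemma measurable_supRatio_right (hy : ∀ t ∈ K, y t ≠ 0) (s : E d) : Measurable (supRatio K y s) :=
  (measurable_supRatio hy).of_uncurry_left

lemma measurableSet_contributes (hy : ∀ t ∈ K, y t ≠ 0) :
    MeasurableSet {p : Storm d | Contributes K y p} := by
  have hpair : Measurable fun p : Storm d => (p.1, p.2.2) := by fun_prop
  have hratio := (measurable_supRatio hy).comp hpair
  exact measurableSet_le (by fun_prop) hratio

lemma supRatio_le (hy : ∀ t ∈ K, c ≤ y t) (hX : IsShape C R X) (s : E d) :
    supRatio K y s X ≤ ENNReal.ofReal C / c :=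
  iSup₂_le fun t ht => ENNReal.div_le_div (ENNReal.ofReal_le_ofReal (hX.le _)) (hy t ht)

lemma supRatio_ne_top (hc : c ≠ 0) (hy : ∀ t ∈ K, c ≤ y t) (hX : IsShape C R X) (s : E d) :
    supRatio K y s X ≠ ∞ :=
  ne_top_of_le_ne_top (ENNReal.div_ne_top ENNReal.ofReal_ne_top hc) (supRatio_le hy hX s)

lemma supRatio_eq_zero (hX : IsShape C R X) {s : E d}
    (hs : s ∉ K + Metric.closedBall (0 : E d) R) : supRatio K y s X = 0 := by
  refine le_antisymm (iSup₂_le fun t ht => ?_) zero_le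
  have hfar : R < ‖t - s‖ := not_le.1 fun hnear => hs (mem_add_closedBall_zero_iff.2 ⟨t, ht, hnear⟩)
  rw [hX.eq_zero _ hfar, ENNReal.ofReal_zero, ENNReal.zero_div]

lemma supRatio_pos (hX : IsShape C R X) {s t : E d} (ht : t ∈ K) (hyt : y t ≠ ∞)
    (hst : ‖t - s‖ < R) : 0 < supRatio K y s X :=
  (ENNReal.div_pos (ENNReal.ofReal_pos.2 (hX.pos _ hst)).ne' hyt).trans_le
    (le_iSup₂_of_le t ht le_rfl)

lemma supRatio_le_add (hy : ∀ t ∈ K, c ≤ y t) {a b : E d} {ε : ℝ}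
    (hab : ∀ t ∈ K, X (t - a) ≤ X (t - b) + ε) :
    supRatio K y a X ≤ supRatio K y b X + ENNReal.ofReal ε / c := by
  refine iSup₂_le fun t ht => ?_
  calc ENNReal.ofReal (X (t - a)) / y t
      ≤ (ENNReal.ofReal (X (t - b)) + ENNReal.ofReal ε) / y t := by
        gcongr
        exact (ENNReal.ofReal_le_ofReal (hab t ht)).trans ENNReal.ofReal_add_le
    _ = ENNReal.ofReal (X (t - b)) / y t + ENNReal.ofReal ε / y t := ENNReal.add_div
    _ ≤ supRatio K y b X + ENNReal.ofReal ε / c :=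
        add_le_add (le_iSup₂_of_le t ht le_rfl) (ENNReal.div_le_div_left (hy t ht) _)

lemma IsShape.uniformContinuous (hX : IsShape C R X) : UniformContinuous X :=
  (HasCompactSupport.intro (isCompact_closedBall (0 : E d) R) fun s hs =>
    hX.eq_zero s (by simpa using hs)).uniformContinuous_of_continuous X.continuous

lemma continuous_supRatio (hc : c ≠ 0) (hy : ∀ t ∈ K, c ≤ y t) (hX : IsShape C R X) :
    Continuous fun s => supRatio K y s X := by
  refine continuous_iff_continuousAt.2 fun s =>
    (ENNReal.tendsto_nhds (supRatio_ne_top hc hy hX s)).2 fun δ hδ => ?_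
  have hlim : Tendsto (fun ε => ENNReal.ofReal ε / c) (𝓝[>] 0) (𝓝 0) := by
    have hcont : Continuous fun ε => ENNReal.ofReal ε / c :=
      (ENNReal.continuous_div_const c hc).comp ENNReal.continuous_ofReal
    exact (hcont.tendsto' 0 0 (by simp)).mono_left nhdsWithin_le_nhds
  obtain ⟨ε, hεδ, hε⟩ := ((hlim.eventually_le_const hδ).and self_mem_nhdsWithin).exists
  obtain ⟨η, hη, hXη⟩ := Metric.uniformContinuous_iff.1 hX.uniformContinuous ε hε
  have hclose : ∀ a b : E d, dist a b < η → supRatio K y a X ≤ supRatio K y b X + δ :=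
    fun a b hab => (supRatio_le_add hy fun t _ => sub_le_iff_le_add'.1
      ((le_abs_self _).trans (hXη (by rwa [dist_sub_left])).le)).trans (by gcongr)
  filter_upwards [Metric.ball_mem_nhds s hη] with a ha
  exact ⟨tsub_le_iff_right.2 (hclose s a (by rwa [dist_comm])), hclose a s ha⟩

lemma bFactor_eq_zero (hX : ∀ᵐ X ∂PX, IsShape C R X) {s : E d}
    (hs : s ∉ K + Metric.closedBall (0 : E d) R) : bFactor μ PX K y s = 0 := by
  rw [bFactor, lintegral_congr_ae (hX.mono fun X hX => supRatio_eq_zero hX hs), lintegral_zero,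
    mul_zero]

section FiniteLaw

variable [IsFiniteMeasure PX]

lemma bFactor_ne_top (hc : c ≠ 0) (hy : ∀ t ∈ K, c ≤ y t) (hX : ∀ᵐ X ∂PX, IsShape C R X)
    (s : E d) : bFactor μ PX K y s ≠ ∞ := by
  have hle : ∫⁻ X, supRatio K y s X ∂PX ≤ ∫⁻ _, ENNReal.ofReal C / c ∂PX :=
    lintegral_mono_ae (hX.mono fun X hX => supRatio_le hy hX s)
  rw [lintegral_const] at hle
  exact ENNReal.mul_ne_top ENNReal.ofReal_ne_top (ne_top_of_le_ne_top (ENNReal.mul_ne_top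
    (ENNReal.div_ne_top ENNReal.ofReal_ne_top hc) (measure_ne_top _ _)) hle)

lemma continuous_bFactor (hc : c ≠ 0) (hy : ∀ t ∈ K, c ≤ y t) (hX : ∀ᵐ X ∂PX, IsShape C R X) :
    Continuous (bFactor μ PX K y) := by
  have hy0 : ∀ t ∈ K, y t ≠ 0 := fun t ht => ne_bot_of_le_ne_bot hc (hy t ht)
  refine (ENNReal.continuous_const_mul ENNReal.ofReal_ne_top).comp
    (continuous_iff_continuousAt.2 fun s => ?_)
  refine tendsto_lintegral_filter_of_dominated_convergence (fun _ => ENNReal.ofReal C / c)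
    (Eventually.of_forall (measurable_supRatio_right hy0))
    (Eventually.of_forall fun a => hX.mono fun X hX => supRatio_le hy hX a) ?_
    (hX.mono fun X hX => (continuous_supRatio hc hy hX).continuousAt)
  rw [lintegral_const]
  exact ENNReal.mul_ne_top (ENNReal.div_ne_top ENNReal.ofReal_ne_top hc) (measure_ne_top _ _)

lemma continuous_toReal_bFactor (hc : c ≠ 0) (hy : ∀ t ∈ K, c ≤ y t)
    (hX : ∀ᵐ X ∂PX, IsShape C R X) : Continuous fun s => (bFactor μ PX K y s).toReal :=
  ENNReal.continuousOn_toReal.comp_continuous (continuous_bFactor hc hy hX)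
    (bFactor_ne_top hc hy hX)

end FiniteLaw

lemma bFactor_pos [NeZero PX] (hμ : 0 < μ) (hy : ∀ t ∈ K, y t ≠ 0)
    (hX : ∀ᵐ X ∂PX, IsShape C R X) {s t : E d} (ht : t ∈ K) (hyt : y t ≠ ∞)
    (hst : ‖t - s‖ < R) : 0 < bFactor μ PX K y s := by
  refine ENNReal.mul_pos (ENNReal.ofReal_pos.2 (inv_pos.2 hμ)).ne' fun hzero => ?_
  rw [lintegral_eq_zero_iff (measurable_supRatio_right hy s)] at hzero
  obtain ⟨X, hX_zero, hX⟩ := (hzero.and hX).exists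
  exact (supRatio_pos hX ht hyt hst).ne' hX_zero

/-- The intensity `b_K^y(s) ψ(s)` of the point process of the centres of the retained storms. -/
noncomputable def retainedIntensity (μ : ℝ) (PX : Measure C(E d, ℝ)) (ψ : C(E d, ℝ))
    (K : Set (E d)) (y : E d → ℝ≥0∞) (s : E d) : ℝ :=
  (bFactor μ PX K y s).toReal * ψ s

lemma retainedIntensity_eq_zero (hX : ∀ᵐ X ∂PX, IsShape C R X) {s : E d}
    (hs : s ∉ K + Metric.closedBall (0 : E d) R) : retainedIntensity μ PX ψ K y s = 0 := by
  rw [retainedIntensity, bFactor_eq_zero hX hs, ENNReal.toReal_zero, zero_mul]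

lemma retainedIntensity_nonneg (hψ : ∀ s, 0 ≤ ψ s) (s : E d) :
    0 ≤ retainedIntensity μ PX ψ K y s :=
  mul_nonneg ENNReal.toReal_nonneg (hψ s)

lemma hasCompactSupport_retainedIntensity (hX : ∀ᵐ X ∂PX, IsShape C R X) (hK : IsCompact K) :
    HasCompactSupport (retainedIntensity μ PX ψ K y) :=
  HasCompactSupport.intro (hK.add (isCompact_closedBall (0 : E d) R))
    fun _ hs => retainedIntensity_eq_zero hX hs

lemma exists_withDensity_retainedIntensity_compl_closedBall_eq_zero
    (hX : ∀ᵐ X ∂PX, IsShape C R X) (hK : IsCompact K) :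
    ∃ r : ℝ, 0 ≤ r ∧ (volume.withDensity fun s => ENNReal.ofReal (retainedIntensity μ PX ψ K y s))
      (Metric.closedBall 0 r)ᶜ = 0 := by
  obtain ⟨r, hr0, hr⟩ :=
    (hK.add (isCompact_closedBall (0 : E d) R)).isBounded.subset_closedBall_lt 0 0
  refine ⟨r, hr0.le, ?_⟩
  rw [withDensity_apply _ Metric.isClosed_closedBall.measurableSet.compl]
  refine (setLIntegral_congr_fun Metric.isClosed_closedBall.measurableSet.compl
    fun s hs => ?_).trans lintegral_zero
  rw [retainedIntensity_eq_zero hX fun hsK => hs (hr hsK), ENNReal.ofReal_zero]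

variable [IsFiniteMeasure PX]

lemma ofReal_retainedIntensity (hc : c ≠ 0) (hy : ∀ t ∈ K, c ≤ y t)
    (hX : ∀ᵐ X ∂PX, IsShape C R X) (s : E d) :
    ENNReal.ofReal (retainedIntensity μ PX ψ K y s) =
      bFactor μ PX K y s * ENNReal.ofReal (ψ s) := by
  rw [retainedIntensity, ENNReal.ofReal_mul ENNReal.toReal_nonneg,
    ENNReal.ofReal_toReal (bFactor_ne_top hc hy hX s)]

lemma map_fst_restrict_contributes (hc : c ≠ 0) (hy : ∀ t ∈ K, c ≤ y t)
    (hX : ∀ᵐ X ∂PX, IsShape C R X) :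
    ((stormIntensity μ PX ψ).restrict {p | Contributes K y p}).map Prod.fst =
      volume.withDensity fun s => ENNReal.ofReal (retainedIntensity μ PX ψ K y s) := by
  have hy0 : ∀ t ∈ K, y t ≠ 0 := fun t ht => ne_bot_of_le_ne_bot hc (hy t ht)
  have hseverity : ∀ s, ∫⁻ X, severityMeasure {u | Contributes K y (s, u, X)} ∂PX =
      ∫⁻ X, supRatio K y s X ∂PX := fun s =>
    lintegral_congr_ae <| hX.mono fun X hX =>
      severityMeasure_setOf_inv_le (supRatio_ne_top hc hy hX s)
  ext A hA
  rw [Measure.map_apply measurable_fst hA, Measure.restrict_apply (measurable_fst hA),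
    stormIntensity_apply ((measurable_fst hA).inter (measurableSet_contributes hy0)),
    withDensity_apply _ hA, ← lintegral_indicator hA,
    ← lintegral_const_mul' _ _ ENNReal.ofReal_ne_top]
  refine lintegral_congr fun s => ?_
  by_cases hs : s ∈ A
  · simp only [Set.mem_inter_iff, Set.mem_preimage, hs, true_and, Set.mem_ofPred_eq, hseverity,
      Set.indicator_of_mem, ofReal_retainedIntensity hc hy hX, bFactor]
    ring
  · simp [hs]

lemma continuous_retainedIntensity (hc : c ≠ 0) (hy : ∀ t ∈ K, c ≤ y t)
    (hX : ∀ᵐ X ∂PX, IsShape C R X) : Continuous (retainedIntensity μ PX ψ K y) :=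
  (continuous_toReal_bFactor hc hy hX).mul ψ.continuous

lemma exists_retainedIntensity_le (hc : c ≠ 0) (hy : ∀ t ∈ K, c ≤ y t)
    (hX : ∀ᵐ X ∂PX, IsShape C R X) (hK : IsCompact K) :
    ∃ M, 0 < M ∧ ∀ s, retainedIntensity μ PX ψ K y s ≤ M := by
  obtain ⟨M, hM⟩ := (hasCompactSupport_retainedIntensity hX hK).exists_bound_of_continuous
    (continuous_retainedIntensity (μ := μ) (ψ := ψ) hc hy hX)
  exact ⟨max M 1, by positivity, fun s => (le_abs_self _).trans ((hM s).trans (le_max_left _ _))⟩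

lemma integrable_retainedIntensity (hc : c ≠ 0) (hy : ∀ t ∈ K, c ≤ y t)
    (hX : ∀ᵐ X ∂PX, IsShape C R X) (hK : IsCompact K) :
    Integrable (retainedIntensity μ PX ψ K y) :=
  (continuous_retainedIntensity hc hy hX).integrable_of_hasCompactSupport
    (hasCompactSupport_retainedIntensity hX hK)

lemma isFiniteMeasure_withDensity_retainedIntensity (hc : c ≠ 0) (hy : ∀ t ∈ K, c ≤ y t)
    (hX : ∀ᵐ X ∂PX, IsShape C R X) (hK : IsCompact K) :
    IsFiniteMeasure
      (volume.withDensity fun s => ENNReal.ofReal (retainedIntensity μ PX ψ K y s)) :=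
  isFiniteMeasure_withDensity_ofReal (integrable_retainedIntensity hc hy hX hK).2

lemma measureReal_univ_withDensity_retainedIntensity (hc : c ≠ 0) (hy : ∀ t ∈ K, c ≤ y t)
    (hX : ∀ᵐ X ∂PX, IsShape C R X) :
    (volume.withDensity fun s => ENNReal.ofReal (retainedIntensity μ PX ψ K y s)).real Set.univ =
      cConst μ PX ψ K y := by
  rw [measureReal_def, withDensity_apply _ .univ, Measure.restrict_univ, cConst]
  simp_rw [ofReal_retainedIntensity hc hy hX]

lemma cConst_eq_integral (hψ : ∀ s, 0 ≤ ψ s) (hc : c ≠ 0) (hy : ∀ t ∈ K, c ≤ y t)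
    (hX : ∀ᵐ X ∂PX, IsShape C R X) :
    cConst μ PX ψ K y = ∫ s, retainedIntensity μ PX ψ K y s := by
  rw [integral_eq_lintegral_of_nonneg_ae (ae_of_all _ (retainedIntensity_nonneg hψ))
    (continuous_retainedIntensity hc hy hX).aestronglyMeasurable, cConst]
  simp_rw [ofReal_retainedIntensity hc hy hX]

lemma cConst_pos [NeZero PX] (hμ : 0 < μ) (hR : 0 < R) (hψ : ∀ s, 0 < ψ s) (hc : c ≠ 0)
    (hy : ∀ t ∈ K, c ≤ y t) (hy_top : ∀ t ∈ K, y t ≠ ∞) (hX : ∀ᵐ X ∂PX, IsShape C R X)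
    (hK : IsCompact K) (hne : K.Nonempty) : 0 < cConst μ PX ψ K y := by
  have hψ0 : ∀ s, 0 ≤ ψ s := fun s => (hψ s).le
  obtain ⟨t, ht⟩ := hne
  have hb : 0 < bFactor μ PX K y t :=
    bFactor_pos hμ (fun t ht => ne_bot_of_le_ne_bot hc (hy t ht)) hX ht (hy_top t ht) (by simpa)
  rw [cConst_eq_integral hψ0 hc hy hX]
  exact (continuous_retainedIntensity hc hy hX).integral_pos_of_hasCompactSupport_nonneg_nonzero
    (hasCompactSupport_retainedIntensity hX hK) (retainedIntensity_nonneg hψ0)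
    (mul_pos (ENNReal.toReal_pos hb.ne' (bFactor_ne_top hc hy hX t)) (hψ t)).ne'

end Retention

section Concentration

variable {d : ℕ}

/-- The indices of the cells of mesh `ρ` that may meet the ball of radius `r`. -/
noncomputable def gridIndex (d : ℕ) (r ρ : ℝ) : Finset (Fin d → ℤ) :=
  Finset.Icc (fun _ => -⌈r / ρ⌉) fun _ => ⌈r / ρ⌉

lemma cellIndex_mem_gridIndex {r ρ : ℝ} (hρ : 0 < ρ) {t : E d} (ht : ‖t‖ ≤ r) :
    cellIndex ρ t ∈ gridIndex d r ρ := by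
  have hcoord : ∀ i, |t i / ρ| ≤ ⌈r / ρ⌉ := fun i => by
    rw [abs_div, abs_of_pos hρ]
    exact (div_le_div_of_nonneg_right ((PiLp.norm_apply_le t i).trans ht) hρ.le).trans
      (Int.le_ceil _)
  refine Finset.mem_Icc.2 ⟨fun i => Int.le_floor.2 ?_, fun i => ?_⟩
  · simpa only [Int.cast_neg] using (abs_le.1 (hcoord i)).1
  · have hle : (cellIndex ρ t i : ℝ) ≤ ⌈r / ρ⌉ := (Int.floor_le _).trans (abs_le.1 (hcoord i)).2
    exact mod_cast hle

lemma card_gridIndex_le {r ρ : ℝ} (hr : 0 ≤ r) (hρ0 : 0 < ρ) (hρ1 : ρ ≤ 1) :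
    ((gridIndex d r ρ).card : ℝ) ≤ ((2 * r + 3) / ρ) ^ d := by
  have hceil : (⌈r / ρ⌉ : ℝ) * ρ ≤ r + ρ := by
    rw [← le_div_iff₀ hρ0, add_div, div_self hρ0.ne']
    exact (Int.ceil_lt_add_one _).le
  have hcard : (gridIndex d r ρ).card = (2 * ⌈r / ρ⌉ + 1).toNat ^ d := by
    simp only [gridIndex, Pi.card_Icc, Int.card_Icc, Finset.prod_const, Finset.card_univ,
      Fintype.card_fin]
    congr 2
    ring
  have hnonneg : 0 ≤ ⌈r / ρ⌉ := Int.ceil_nonneg (by positivity)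
  have hcast : ((2 * ⌈r / ρ⌉ + 1).toNat : ℝ) = 2 * ⌈r / ρ⌉ + 1 :=
    mod_cast congrArg (Int.cast (R := ℝ)) (Int.toNat_of_nonneg (by lia : 0 ≤ 2 * ⌈r / ρ⌉ + 1))
  rw [hcard, Nat.cast_pow, hcast]
  gcongr
  rw [le_div_iff₀ hρ0]
  linarith

/-- A sequence of bandwidths: `h_m > 0`, `h_m → 0` and `m h_m^d / |log m| → ∞`. -/
structure IsBandwidth (d : ℕ) (h : ℕ → ℝ) : Prop where
  pos : ∀ m, 0 < h m
  tendsto_zero : Tendsto h atTop (𝓝 0)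
  tendsto_rate : Tendsto (fun m : ℕ => m * h m ^ d / |Real.log m|) atTop atTop

namespace IsBandwidth

variable {h : ℕ → ℝ}

lemma eventually_exp_le (hh : IsBandwidth d h) {κ : ℝ} (hκ : 0 < κ) (q : ℕ) :
    ∀ᶠ m : ℕ in atTop, Real.exp (-(κ * (m * h m ^ d))) ≤ ((m : ℝ) ^ q)⁻¹ := by
  filter_upwards [hh.tendsto_rate.eventually_ge_atTop (q / κ), eventually_gt_atTop 1]
    with m hrate hm
  have hlog : 0 < Real.log m := Real.log_pos (mod_cast hm)
  have hm0 : (0 : ℝ) < m := mod_cast zero_lt_one.trans hm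
  rw [abs_of_pos hlog, le_div_iff₀ hlog, div_mul_eq_mul_div, div_le_iff₀' hκ] at hrate
  calc Real.exp (-(κ * (m * h m ^ d))) ≤ Real.exp (-(q * Real.log m)) :=
        Real.exp_le_exp.2 (neg_le_neg hrate)
    _ = ((m : ℝ) ^ q)⁻¹ := by rw [Real.exp_neg, Real.exp_nat_mul, Real.exp_log hm0]

lemma eventually_one_le (hh : IsBandwidth d h) : ∀ᶠ m : ℕ in atTop, 1 ≤ m * h m ^ d := by
  have hlog : ∀ᶠ m : ℕ in atTop, 1 ≤ |Real.log m| :=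
    (tendsto_abs_atTop_atTop.comp (Real.tendsto_log_atTop.comp
      tendsto_natCast_atTop_atTop)).eventually_ge_atTop 1
  filter_upwards [hh.tendsto_rate.eventually_ge_atTop 1, hlog] with m hrate hlog
  exact hlog.trans ((one_le_div₀ (one_pos.trans_le hlog)).1 hrate)

lemma eventually_card_gridIndex_le (hh : IsBandwidth d h) {r δ : ℝ} (hr : 0 ≤ r) (hδ0 : 0 < δ)
    (hδ1 : δ ≤ 1) :
    ∀ᶠ m : ℕ in atTop, ((gridIndex d r (δ * h m)).card : ℝ) ≤ (m : ℝ) ^ 2 := by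
  filter_upwards [hh.tendsto_zero.eventually_le_const one_pos, hh.eventually_one_le,
    tendsto_natCast_atTop_atTop.eventually_ge_atTop (((2 * r + 3) / δ) ^ d)] with m hh1 hone hm
  have hhm : 0 < h m := hh.pos m
  calc ((gridIndex d r (δ * h m)).card : ℝ)
      ≤ ((2 * r + 3) / (δ * h m)) ^ d :=
        card_gridIndex_le hr (by positivity) (mul_le_one₀ hδ1 hhm.le hh1)
    _ = ((2 * r + 3) / δ) ^ d * (1 / h m ^ d) := by rw [← div_div, div_pow _ (h m), mul_one_div]
    _ ≤ m * m := by
        gcongr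
        rwa [div_le_iff₀ (by positivity)]
    _ = (m : ℝ) ^ 2 := (sq _).symm

end IsBandwidth

variable {Ω S : Type*} [MeasurableSpace Ω] [MeasurableSpace S] {P : Measure Ω}

lemma ae_eventually_of_summable [IsFiniteMeasure P] {p : ℕ → Ω → Prop} {u : ℕ → ℝ}
    (hu : Summable u) (hp : ∀ᶠ n in atTop, P.real {ω | ¬ p n ω} ≤ u n) :
    ∀ᵐ ω ∂P, ∀ᶠ n in atTop, p n ω := by
  have hsummable : Summable fun n => P.real {ω | ¬ p n ω} :=
    Summable.of_norm_bounded_eventually_nat hu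
      (hp.mono fun n hn => by rwa [Real.norm_of_nonneg measureReal_nonneg])
  have hsum : ∑' n, P {ω | ¬ p n ω} ≠ ∞ := by
    simpa only [ofReal_measureReal (measure_ne_top P _)] using hsummable.tsum_ofReal_ne_top
  filter_upwards [ae_eventually_notMem hsum] with ω hω
  exact hω.mono fun n hn => not_not.1 hn

lemma ae_eventually_forall_of_summable [IsFiniteMeasure P] {ι : Type*} {s : ℕ → Finset ι}
    {p : ℕ → ι → Ω → Prop} {u : ℕ → ℝ} (hu : Summable u)
    (hp : ∀ᶠ n in atTop, ∑ i ∈ s n, P.real {ω | ¬ p n i ω} ≤ u n) :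
    ∀ᵐ ω ∂P, ∀ᶠ n in atTop, ∀ i ∈ s n, p n i ω := by
  refine ae_eventually_of_summable hu (hp.mono fun n hn => ?_)
  have hunion : {ω | ¬ ∀ i ∈ s n, p n i ω} = ⋃ i ∈ s n, {ω | ¬ p n i ω} := by
    ext ω
    simp
  rw [hunion]
  exact (measureReal_biUnion_finset_le _ _).trans hn

/-- The `n` for which `n c` and `m` agree up to a factor `2`. -/
noncomputable def comparableIndices (c : ℝ) (m : ℕ) : Finset ℕ :=
  {n ∈ Finset.range (⌊2 * m / c⌋₊ + 1) | (m : ℝ) ≤ 2 * (n * c)}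

lemma mem_comparableIndices {c : ℝ} (hc : 0 < c) {m n : ℕ} :
    n ∈ comparableIndices c m ↔ n * c ≤ 2 * m ∧ m ≤ 2 * (n * c) := by
  rw [comparableIndices, Finset.mem_filter, Finset.mem_range, Nat.lt_succ_iff,
    Nat.le_floor_iff (by positivity), le_div_iff₀ hc]

lemma card_comparableIndices_le {c : ℝ} (hc : 0 < c) (m : ℕ) :
    ((comparableIndices c m).card : ℝ) ≤ 2 * m / c + 1 := by
  have hcard : (comparableIndices c m).card ≤ ⌊2 * m / c⌋₊ + 1 :=
    (Finset.card_filter_le _ _).trans_eq (Finset.card_range _)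
  calc ((comparableIndices c m).card : ℝ) ≤ (⌊2 * m / c⌋₊ : ℝ) + 1 := mod_cast hcard
    _ ≤ 2 * m / c + 1 := by gcongr; exact Nat.floor_le (by positivity)

lemma tendsto_atTop_of_tendsto_div {c : ℝ} (hc : 0 < c) {m : ℕ → ℕ}
    (hm : Tendsto (fun n => (m n : ℝ) / n) atTop (𝓝 c)) : Tendsto m atTop atTop := by
  refine tendsto_natCast_atTop_iff.1 ((hm.pos_mul_atTop hc tendsto_natCast_atTop_atTop).congr' ?_)
  filter_upwards [eventually_ne_atTop 0] with n hn
  exact div_mul_cancel₀ _ (Nat.cast_ne_zero.2 hn)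

namespace HasPoissonCounts

variable [IsProbabilityMeasure P]

lemma ae_tendsto_div {ν : ℕ → Ω → Measure S} {F : Measure S} (hν : HasPoissonCounts P ν F)
    {A : Set S} (hA : MeasurableSet A) (hF : F A < ∞) :
    ∀ᵐ ω ∂P, Tendsto (fun n : ℕ => (ν n ω).real A / n) atTop (𝓝 (F.real A)) := by
  have hclose : ∀ q : ℕ, ∀ᵐ ω ∂P, ∀ᶠ n : ℕ in atTop,
      |(ν n ω).real A - n * F.real A| < 1 / ((q : ℝ) + 1) * (n * 1) := fun q => by
    obtain ⟨κ, hκ, hle⟩ := hν.exists_measureReal_abs_sub_ge_le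
      (η := 1 / ((q : ℝ) + 1)) (D := F.real A + 1) (by positivity) (by positivity)
    refine ae_eventually_of_summable
      ((Real.summable_exp_nat_mul_iff.2 (neg_lt_zero.2 hκ)).mul_left 2)
      (Eventually.of_forall fun n => ?_)
    simp only [not_lt]
    refine (hle A hA hF n 1 zero_le_one (by linarith)).trans_eq ?_
    rw [mul_one, mul_neg, mul_comm κ]
  filter_upwards [ae_all_iff.2 hclose] with ω hω
  refine Metric.tendsto_nhds.2 fun ε hε => ?_
  obtain ⟨q, hq⟩ := exists_nat_one_div_lt hε
  filter_upwards [hω q, eventually_gt_atTop 0] with n hn hn0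
  have hn_pos : (0 : ℝ) < n := mod_cast hn0
  rw [Real.dist_eq, div_sub' hn_pos.ne', abs_div, abs_of_pos hn_pos, div_lt_iff₀ hn_pos]
  rw [mul_one] at hn
  exact hn.trans (by gcongr)

variable {ν : ℕ → Ω → Measure (E d)} {F : Measure (E d)} [IsFiniteMeasure F] {h : ℕ → ℝ}
  {c r δ η D : ℝ}

/-- There are at most `m ^ 2` cells and `O(m)` admissible `n`, and each deviation has probability
at most `2 / m ^ 5`. -/
lemma ae_eventually_abs_sub_lt (hν : HasPoissonCounts P ν F) (hh : IsBandwidth d h)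
    (hc : 0 < c) (hr : 0 ≤ r) (hδ0 : 0 < δ) (hδ1 : δ ≤ 1) (hη : 0 < η) (hD : 0 < D)
    (hFD : ∀ ρ > 0, ∀ z, F.real (cell ρ z) ≤ D * ρ ^ d) :
    ∀ᵐ ω ∂P, ∀ᶠ m : ℕ in atTop, ∀ q ∈ comparableIndices c m ×ˢ gridIndex d r (δ * h m),
      |(ν q.1 ω).real (cell (δ * h m) q.2) - q.1 * F.real (cell (δ * h m) q.2)| <
        η * (q.1 * h m ^ d) := by
  obtain ⟨κ, hκ, hle⟩ :=
    hν.exists_measureReal_abs_sub_ge_le hη (D := D * δ ^ d) (by positivity)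
  refine ae_eventually_forall_of_summable (u := fun m : ℕ => 2 * (2 / c + 1) * ((m : ℝ) ^ 2)⁻¹)
    ((Real.summable_nat_pow_inv.2 one_lt_two).mul_left _) ?_
  filter_upwards [hh.eventually_exp_le (κ := κ / (2 * c)) (by positivity) 5,
    hh.eventually_card_gridIndex_le hr hδ0 hδ1, eventually_ge_atTop 1] with m hexp hcard hm
  have hhm : 0 < h m := hh.pos m
  have hm1 : (1 : ℝ) ≤ m := mod_cast hm
  have hprob : ∀ q ∈ comparableIndices c m ×ˢ gridIndex d r (δ * h m),
      P.real {ω | ¬ |(ν q.1 ω).real (cell (δ * h m) q.2) - q.1 * F.real (cell (δ * h m) q.2)| <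
        η * (q.1 * h m ^ d)} ≤ 2 * ((m : ℝ) ^ 5)⁻¹ := fun q hq => by
    simp only [not_lt]
    refine (hle _ (measurableSet_cell _ _) (measure_lt_top _ _) q.1 (h m ^ d) (by positivity)
      ((hFD _ (by positivity) _).trans_eq (by rw [mul_pow, mul_assoc]))).trans ?_
    have hqm := ((mem_comparableIndices hc).1 (Finset.mem_product.1 hq).1).2
    refine mul_le_mul_of_nonneg_left ((Real.exp_le_exp.2 (neg_le_neg ?_)).trans hexp) two_pos.le
    calc κ / (2 * c) * (m * h m ^ d) ≤ κ / (2 * c) * (2 * (q.1 * c) * h m ^ d) := by gcongr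
      _ = κ * (q.1 * h m ^ d) := by field_simp
  refine (Finset.sum_le_card_nsmul _ _ _ hprob).trans ?_
  rw [nsmul_eq_mul, Finset.card_product, Nat.cast_mul]
  calc ((comparableIndices c m).card : ℝ) * (gridIndex d r (δ * h m)).card * (2 * ((m : ℝ) ^ 5)⁻¹)
      ≤ (2 * m / c + m) * (m : ℝ) ^ 2 * (2 * ((m : ℝ) ^ 5)⁻¹) := by
        gcongr
        exact (card_comparableIndices_le hc m).trans (by gcongr)
    _ = 2 * (2 / c + 1) * ((m : ℝ) ^ 2)⁻¹ := by field_simp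

lemma ae_eventually_abs_sub_le (hν : HasPoissonCounts P ν F) (hh : IsBandwidth d h)
    (hc : 0 < c) (hr : 0 ≤ r) (hδ0 : 0 < δ) (hδ1 : δ ≤ 1) (hη : 0 < η) (hD : 0 < D)
    (hFD : ∀ ρ > 0, ∀ z, F.real (cell ρ z) ≤ D * ρ ^ d) (hFr : F (Metric.closedBall 0 r)ᶜ = 0) :
    ∀ᵐ ω ∂P, ∀ᶠ m : ℕ in atTop, ∀ n ∈ comparableIndices c m, ∀ z,
      |(ν n ω).real (cell (δ * h m) z) - n * F.real (cell (δ * h m) z)| ≤ η * (n * h m ^ d) := by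
  filter_upwards [hν.ae_eventually_abs_sub_lt hh hc hr hδ0 hδ1 hη hD hFD,
    hν.ae_eq_zero Metric.isClosed_closedBall.measurableSet.compl hFr] with ω hgrid hνr
  filter_upwards [hgrid] with m hm n hn z
  have hhm : 0 < h m := hh.pos m
  by_cases hz : z ∈ gridIndex d r (δ * h m)
  · exact (hm (n, z) (Finset.mk_mem_product hn hz)).le
  · have hfar : cell (δ * h m) z ⊆ (Metric.closedBall (0 : E d) r)ᶜ := fun t ht htr => by
      rw [← (show cellIndex (δ * h m) t = z from ht)] at hz
      exact hz (cellIndex_mem_gridIndex (by positivity) (mem_closedBall_zero_iff.1 htr))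
    rw [measureReal_def, measureReal_def, measure_mono_null hfar (hνr n),
      measure_mono_null hfar hFr, ENNReal.toReal_zero, mul_zero, sub_zero, abs_zero]
    positivity

lemma ae_cellwiseClose (hν : HasPoissonCounts P ν F) (hh : IsBandwidth d h)
    (hc : 0 < c) (hr : 0 ≤ r) (hD : 0 < D) (hFD : ∀ ρ > 0, ∀ z, F.real (cell ρ z) ≤ D * ρ ^ d)
    (hFr : F (Metric.closedBall 0 r)ᶜ = 0) :
    ∀ᵐ ω ∂P, ∀ m : ℕ → ℕ, Tendsto (fun n => (m n : ℝ) / n) atTop (𝓝 c) →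
      CellwiseClose (fun n : ℕ => (n : ℝ≥0)⁻¹ • ν n ω) F (fun n => h (m n)) atTop := by
  filter_upwards [ae_all_iff.2 fun p : ℕ => ae_all_iff.2 fun q : ℕ =>
    hν.ae_eventually_abs_sub_le hh hc hr (δ := 1 / ((p : ℝ) + 1)) (η := 1 / ((q : ℝ) + 1))
      (by positivity) ((div_le_one₀ (by positivity)).2 (by simp)) (by positivity) hD hFD hFr]
    with ω hω m hm p η hη
  obtain ⟨q, hq⟩ := exists_nat_one_div_lt hη
  filter_upwards [(tendsto_atTop_of_tendsto_div hc hm).eventually (hω p q),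
    hm.eventually_le_const (lt_two_mul_self hc), hm.eventually_const_le (half_lt_self hc),
    eventually_gt_atTop 0] with n hn hle hge hn0 z
  have hn_pos : (0 : ℝ) < n := mod_cast hn0
  rw [div_le_iff₀ hn_pos] at hle
  rw [le_div_iff₀ hn_pos] at hge
  have hcell := hn n ((mem_comparableIndices hc).2 ⟨by linarith, by linarith⟩) z
  rw [measureReal_nnreal_smul_apply, NNReal.coe_inv, NNReal.coe_natCast, inv_mul_eq_div,
    div_sub' hn_pos.ne', abs_div, abs_of_pos hn_pos, div_le_iff₀ hn_pos]
  have hhm : 0 < h (m n) := hh.pos _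
  calc _ ≤ 1 / ((q : ℝ) + 1) * (n * h (m n) ^ d) := hcell
    _ ≤ η * (n * h (m n) ^ d) := by gcongr
    _ = η * h (m n) ^ d * n := by ring

end HasPoissonCounts

end Concentration

section Centres

variable {d : ℕ} {K : Set (E d)} {y : E d → ℝ≥0∞} {x : ℕ → ℕ → Storm d}

lemma finite_sampleIndex (hfin : ∀ j, {i | Contributes K y (x j i)}.Finite) (n : ℕ) :
    (sampleIndex K y x n).Finite :=
  ((Set.finite_lt_nat n).biUnion fun j _ => (hfin j).image (Prod.mk j)).subset fun q hq =>
    Set.mem_biUnion hq.1 ⟨q.2, hq.2, rfl⟩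

/-- The counting measure `φ_0 + ⋯ + φ_{n-1}` of the centres of the storms that are retained by the
threshold `y` on `K`. -/
noncomputable def centreMeasure (K : Set (E d)) (y : E d → ℝ≥0∞) (x : ℕ → ℕ → Storm d) (n : ℕ) :
    Measure (E d) :=
  ((superposition x n).restrict {p | Contributes K y p}).map Prod.fst

lemma centreMeasure_eq_sum (hT : MeasurableSet {p : Storm d | Contributes K y p})
    (hfin : ∀ j, {i | Contributes K y (x j i)}.Finite) (n : ℕ) :
    centreMeasure K y x n =
      ∑ q ∈ (finite_sampleIndex hfin n).toFinset, Measure.dirac (x q.1 q.2).1 := by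
  have hrestrict : (superposition x n).restrict {p | Contributes K y p} =
      ∑ j ∈ Finset.range n, ∑ i ∈ (hfin j).toFinset, Measure.dirac (x j i) := by
    rw [superposition, ← Measure.restrictₗ_apply, map_sum]
    exact Finset.sum_congr rfl fun j _ => pointMeasure_restrict_eq_sum hT (hfin j)
  rw [centreMeasure, hrestrict, Measure.map_finset_sum measurable_fst.aemeasurable,
    Finset.sum_finset_product _ (Finset.range n) (fun j => (hfin j).toFinset)
      (fun q => by simp [sampleIndex])]
  refine Finset.sum_congr rfl fun j _ => ?_
  rw [Measure.map_finset_sum measurable_fst.aemeasurable]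
  exact Finset.sum_congr rfl fun i _ => Measure.map_dirac' measurable_fst _

lemma isFiniteMeasure_centreMeasure (hT : MeasurableSet {p : Storm d | Contributes K y p})
    (hfin : ∀ j, {i | Contributes K y (x j i)}.Finite) (n : ℕ) :
    IsFiniteMeasure (centreMeasure K y x n) := by
  rw [centreMeasure_eq_sum hT hfin]
  infer_instance

lemma measureReal_univ_centreMeasure (hT : MeasurableSet {p : Storm d | Contributes K y p})
    (hfin : ∀ j, {i | Contributes K y (x j i)}.Finite) (n : ℕ) :
    (centreMeasure K y x n).real Set.univ = sampleCount K y x n := by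
  rw [centreMeasure_eq_sum hT hfin, measureReal_def, Measure.finsetSum_apply, sampleCount,
    Set.ncard_eq_toFinset_card _ (finite_sampleIndex hfin n)]
  simp

lemma integral_centreMeasure (hT : MeasurableSet {p : Storm d | Contributes K y p})
    (hfin : ∀ j, {i | Contributes K y (x j i)}.Finite) (n : ℕ) (f : E d → ℝ) :
    ∫ t, f t ∂(centreMeasure K y x n) = ∑ᶠ q ∈ sampleIndex K y x n, f (x q.1 q.2).1 := by
  rw [centreMeasure_eq_sum hT hfin, integral_finsetSum_measure
    fun q _ => integrable_dirac (by simp), finsum_mem_eq_finite_toFinset_sum _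
    (finite_sampleIndex hfin n)]
  simp only [integral_dirac]

lemma mul_correctedEstimator_eq {μ : ℝ} {PX : Measure C(E d, ℝ)}
    (hT : MeasurableSet {p : Storm d | Contributes K y p})
    (hfin : ∀ j, {i | Contributes K y (x j i)}.Finite) (c : ℝ) (k : E d → ℝ) (h : ℕ → ℝ) {n : ℕ}
    (hn : n ≠ 0) (s : E d) :
    c * correctedEstimator μ PX k h K y x n s =
      (bFactor μ PX K y s).toReal⁻¹ * (c / (sampleCount K y x n / n) *
        ((h (sampleCount K y x n) ^ d)⁻¹ * ∫ t, k ((h (sampleCount K y x n))⁻¹ • (s - t))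
          ∂((n : ℝ≥0)⁻¹ • centreMeasure K y x n))) := by
  have hn' : (n : ℝ) ≠ 0 := Nat.cast_ne_zero.2 hn
  rw [correctedEstimator, kernelEstimator,
    ← integral_centreMeasure hT hfin n fun t => k ((h (sampleCount K y x n))⁻¹ • (s - t)),
    integral_smul_nnreal_measure, NNReal.smul_def, NNReal.coe_inv, NNReal.coe_natCast, smul_eq_mul,
    one_div, mul_inv, div_div_eq_mul_div, div_eq_mul_inv]
  field_simp

end Centres

section Consistency

lemma tendstoUniformlyOn_mul_mul {α ι : Type*} [TopologicalSpace α] {l : Filter ι} {A : Set α}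
    (hA : IsCompact A) {r : ι → ℝ} (hr : Tendsto r l (𝓝 1)) {a f : α → ℝ} (ha : ContinuousOn a A)
    (hf : ContinuousOn f A) {G : ι → α → ℝ} (hG : TendstoUniformlyOn G f l A) :
    TendstoUniformlyOn (fun i s => a s * (r i * G i s)) (fun s => a s * f s) l A := by
  have hrG := (hr.tendstoUniformlyOn_const A).tendstoLocallyUniformlyOn.mul₀
    hG.tendstoLocallyUniformlyOn continuousOn_const hf
  have ha' : TendstoUniformlyOn (fun _ => a) a l A := fun _ hu =>
    Eventually.of_forall fun _ _ _ => refl_mem_uniformity hu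
  have hprod := ha'.tendstoLocallyUniformlyOn.mul₀ hrG ha (continuousOn_const.mul hf)
  refine ((tendstoLocallyUniformlyOn_iff_tendstoUniformlyOn_of_compact hA).1 hprod).congr_right
    fun s _ => ?_
  simp only [Pi.mul_apply, one_mul]

namespace IsIIDPoisson

variable {d : ℕ} {C R μ : ℝ} {c : ℝ≥0∞} {PX : Measure C(E d, ℝ)} [IsFiniteMeasure PX]
  {ψ : C(E d, ℝ)} {K : Set (E d)} {y : E d → ℝ≥0∞} {Ω : Type*} [MeasurableSpace Ω]
  {P : Measure Ω} {x : ℕ → ℕ → Ω → Storm d} {k : E d → ℝ} {h : ℕ → ℝ}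

lemma ae_finite_contributes (hx : IsIIDPoisson P x (stormIntensity μ PX ψ)) (hc : c ≠ 0)
    (hy : ∀ t ∈ K, c ≤ y t) (hX : ∀ᵐ X ∂PX, IsShape C R X) (hK : IsCompact K) :
    ∀ᵐ ω ∂P, ∀ j, {i | Contributes K y (x j i ω)}.Finite := by
  have hT : MeasurableSet {p : Storm d | Contributes K y p} :=
    measurableSet_contributes fun t ht => ne_bot_of_le_ne_bot hc (hy t ht)
  have := isFiniteMeasure_withDensity_retainedIntensity (μ := μ) (ψ := ψ) hc hy hX hK
  refine ae_all_iff.2 fun j => (hx.poisson j).ae_finite hT ?_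
  rw [← Measure.restrict_apply_univ, ← Set.preimage_univ (f := Prod.fst),
    ← Measure.map_apply measurable_fst .univ, map_fst_restrict_contributes hc hy hX]
  exact measure_lt_top _ _

variable [IsProbabilityMeasure P]

lemma hasPoissonCounts_centreMeasure (hx : IsIIDPoisson P x (stormIntensity μ PX ψ)) (hc : c ≠ 0)
    (hy : ∀ t ∈ K, c ≤ y t) (hX : ∀ᵐ X ∂PX, IsShape C R X) :
    HasPoissonCounts P (fun n ω => centreMeasure K y (fun j i => x j i ω) n)
      (volume.withDensity fun s => ENNReal.ofReal (retainedIntensity μ PX ψ K y s)) := by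
  have hcounts := hx.hasPoissonCounts.map_restrict
    (measurableSet_contributes fun t ht => ne_bot_of_le_ne_bot hc (hy t ht)) measurable_fst
  rwa [map_fst_restrict_contributes hc hy hX] at hcounts

lemma ae_tendsto_sampleCount_div (hx : IsIIDPoisson P x (stormIntensity μ PX ψ)) (hc : c ≠ 0)
    (hy : ∀ t ∈ K, c ≤ y t) (hX : ∀ᵐ X ∂PX, IsShape C R X) (hK : IsCompact K) :
    ∀ᵐ ω ∂P, Tendsto (fun n : ℕ => (sampleCount K y (fun j i => x j i ω) n : ℝ) / n) atTop
      (𝓝 (cConst μ PX ψ K y)) := by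
  have hT : MeasurableSet {p : Storm d | Contributes K y p} :=
    measurableSet_contributes fun t ht => ne_bot_of_le_ne_bot hc (hy t ht)
  have := isFiniteMeasure_withDensity_retainedIntensity (μ := μ) (ψ := ψ) hc hy hX hK
  filter_upwards [hx.ae_finite_contributes hc hy hX hK,
    (hx.hasPoissonCounts_centreMeasure hc hy hX).ae_tendsto_div .univ (measure_lt_top _ _)]
    with ω hfin hlim
  simpa only [measureReal_univ_centreMeasure hT hfin,
    measureReal_univ_withDensity_retainedIntensity hc hy hX] using hlim

lemma ae_cellwiseClose_centreMeasure (hx : IsIIDPoisson P x (stormIntensity μ PX ψ))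
    (hh : IsBandwidth d h) (hc : c ≠ 0) (hy : ∀ t ∈ K, c ≤ y t)
    (hX : ∀ᵐ X ∂PX, IsShape C R X) (hK : IsCompact K) (hpos : 0 < cConst μ PX ψ K y) :
    ∀ᵐ ω ∂P, CellwiseClose (fun n : ℕ => (n : ℝ≥0)⁻¹ • centreMeasure K y (fun j i => x j i ω) n)
      (volume.withDensity fun s => ENNReal.ofReal (retainedIntensity μ PX ψ K y s))
      (fun n => h (sampleCount K y (fun j i => x j i ω) n)) atTop := by
  obtain ⟨M, hM0, hM⟩ := exists_retainedIntensity_le (μ := μ) (ψ := ψ) hc hy hX hK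
  obtain ⟨r, hr0, hr⟩ :=
    exists_withDensity_retainedIntensity_compl_closedBall_eq_zero (μ := μ) (ψ := ψ) (y := y) hX hK
  have := isFiniteMeasure_withDensity_retainedIntensity (μ := μ) (ψ := ψ) hc hy hX hK
  filter_upwards [hx.ae_tendsto_sampleCount_div hc hy hX hK,
    (hx.hasPoissonCounts_centreMeasure hc hy hX).ae_cellwiseClose hh hpos hr0 hM0
      (fun ρ hρ => measureReal_withDensity_cell_le hM0.le hM hρ) hr] with ω hlim hclose
  exact hclose _ hlim

lemma ae_tendstoUniformly_smoothing (hx : IsIIDPoisson P x (stormIntensity μ PX ψ))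
    (hk : IsSmoothingKernel k) (hh : IsBandwidth d h) (hψ : ∀ s, 0 ≤ ψ s) (hc : c ≠ 0)
    (hy : ∀ t ∈ K, c ≤ y t) (hX : ∀ᵐ X ∂PX, IsShape C R X) (hK : IsCompact K)
    (hpos : 0 < cConst μ PX ψ K y) :
    ∀ᵐ ω ∂P, TendstoUniformly (fun (n : ℕ) s =>
      (h (sampleCount K y (fun j i => x j i ω) n) ^ d)⁻¹ *
        ∫ t, k ((h (sampleCount K y (fun j i => x j i ω) n))⁻¹ • (s - t))
          ∂((n : ℝ≥0)⁻¹ • centreMeasure K y (fun j i => x j i ω) n))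
      (retainedIntensity μ PX ψ K y) atTop := by
  obtain ⟨M, -, hM⟩ := exists_retainedIntensity_le (μ := μ) (ψ := ψ) hc hy hX hK
  filter_upwards [hx.ae_finite_contributes hc hy hX hK, hx.ae_tendsto_sampleCount_div hc hy hX hK,
    hx.ae_cellwiseClose_centreMeasure hh hc hy hX hK hpos] with ω hfin hlim hclose
  have hcount : Tendsto (sampleCount K y fun j i => x j i ω) atTop atTop :=
    tendsto_atTop_of_tendsto_div hpos hlim
  have := fun n => isFiniteMeasure_centreMeasure
    (measurableSet_contributes fun t ht => ne_bot_of_le_ne_bot hc (hy t ht)) hfin n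
  exact hclose.tendstoUniformly_inv_mul_integral hk
    ((hasCompactSupport_retainedIntensity hX hK).uniformContinuous_of_continuous
      (continuous_retainedIntensity hc hy hX))
    (retainedIntensity_nonneg hψ) hM (integrable_retainedIntensity hc hy hX hK)
    (fun _ => hh.pos _) (hh.tendsto_zero.comp hcount)

theorem ae_tendstoUniformlyOn [NeZero PX] (hx : IsIIDPoisson P x (stormIntensity μ PX ψ))
    (hk : IsSmoothingKernel k) (hh : IsBandwidth d h) (hμ : 0 < μ) (hR : 0 < R)
    (hψ : ∀ s, 0 < ψ s) (hc : c ≠ 0) (hy : ∀ t ∈ K, c ≤ y t) (hy_top : ∀ t ∈ K, y t ≠ ∞)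
    (hX : ∀ᵐ X ∂PX, IsShape C R X) (hK : IsCompact K) (hne : K.Nonempty) :
    ∀ᵐ ω ∂P, ∀ ε : ℝ, 0 < ε → TendstoUniformlyOn
      (fun n s => cConst μ PX ψ K y *
        correctedEstimator μ PX k h K y (fun j i => x j i ω) n s)
      ψ atTop (K + Metric.closedBall (0 : E d) (R - ε)) := by
  have hy0 : ∀ t ∈ K, y t ≠ 0 := fun t ht => ne_bot_of_le_ne_bot hc (hy t ht)
  have hpos : 0 < cConst μ PX ψ K y := cConst_pos hμ hR hψ hc hy hy_top hX hK hne
  filter_upwards [hx.ae_finite_contributes hc hy hX hK, hx.ae_tendsto_sampleCount_div hc hy hX hK,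
    hx.ae_tendstoUniformly_smoothing hk hh (fun s => (hψ s).le) hc hy hX hK hpos]
    with ω hfin hlim hsmooth ε hε
  have hA : IsCompact (K + Metric.closedBall (0 : E d) (R - ε)) :=
    hK.add (isCompact_closedBall _ _)
  have hratio : Tendsto (fun n : ℕ => cConst μ PX ψ K y /
      (sampleCount K y (fun j i => x j i ω) n / n)) atTop (𝓝 1) := by
    have hdiv := (tendsto_const_nhds (x := cConst μ PX ψ K y)).div hlim hpos.ne'
    rwa [div_self hpos.ne'] at hdiv
  have hb : ∀ s ∈ K + Metric.closedBall (0 : E d) (R - ε), (bFactor μ PX K y s).toReal ≠ 0 :=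
    fun s hs => by
      obtain ⟨t, ht, hts⟩ := mem_add_closedBall_zero_iff.1 hs
      have hbpos := bFactor_pos hμ hy0 hX ht (hy_top t ht) (by linarith : ‖t - s‖ < R)
      exact (ENNReal.toReal_pos hbpos.ne' (bFactor_ne_top hc hy hX s)).ne'
  refine ((tendstoUniformlyOn_mul_mul hA hratio
    ((continuous_toReal_bFactor hc hy hX).continuousOn.inv₀ hb)
    (continuous_retainedIntensity hc hy hX).continuousOn hsmooth.tendstoUniformlyOn).congr
    ?_).congr_right fun s hs => inv_mul_cancel_left₀ (hb s hs) _
  filter_upwards [eventually_ne_atTop 0] with n hn s _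
  exact (mul_correctedEstimator_eq (measurableSet_contributes hy0) hfin _ k h hn s).symm

end IsIIDPoisson

end Consistency

end CoxExtremal

open CoxExtremal in
/-- `PX` is the law of the storm process, `PΨ` the law of the intensity process. Conditionally on
`Ψ = ψ`, the threshold field `Y*` is the extremal field of the Poisson storm process `xs` (on `Ωs`,
under `κs ψ`), and, independently of it, the samples `φ_0, φ_1, …` come from independent Poisson
storm processes `x 0, x 1, …` (on `Ω`, under `κ ψ`) with the same directing measure. The conclusion
is for almost every `ψ`, almost every realization `y` of `Y*` given `ψ`, and almost surely in the
samples. -/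
theorem corollary1 {d : ℕ} (hd : 0 < d)
    -- the storm process
    (PX : Measure C(E d, ℝ)) [IsProbabilityMeasure PX]
    (hX_nonneg : ∀ᵐ X ∂PX, ∀ s, 0 ≤ X s)
    (C R : ℝ) (hC : 0 < C) (hR : 0 < R)
    (hX_bdd : ∀ᵐ X ∂PX, ∀ s, X s ≤ C * (Metric.closedBall (0 : E d) R).indicator 1 s)
    (hX_supp : ∃ r : ℝ, 0 < r ∧
      0 < PX {X | Metric.closedBall (0 : E d) r ⊆ {s | 0 < X s}})
    (hX_pos : ∀ᵐ X ∂PX, ∀ s : E d, ‖s‖ < R → 0 < X s)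
    -- the intensity process and the scaling constant
    (PΨ : Measure C(E d, ℝ)) [IsProbabilityMeasure PΨ]
    (hΨ_pos : ∀ᵐ ψ ∂PΨ, ∀ s, 0 < ψ s)
    (μ : ℝ) (hμ : 0 < μ)
    -- conditionally on the intensity: the storms that generate the threshold field
    {Ωs : Type*} [MeasurableSpace Ωs] (κs : Kernel C(E d, ℝ) Ωs) [IsMarkovKernel κs]
    (xs : ℕ → Ωs → Storm d)
    (hxs : ∀ᵐ ψ ∂PΨ, IsPoissonProcess (κs ψ) xs (stormIntensity μ PX ψ))
    -- conditionally on the intensity and the threshold: the storms that generate the samples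
    {Ω : Type*} [MeasurableSpace Ω] (κ : Kernel C(E d, ℝ) Ω) [IsMarkovKernel κ]
    (x : ℕ → ℕ → Ω → Storm d)
    (hx : ∀ᵐ ψ ∂PΨ, IsIIDPoisson (κ ψ) x (stormIntensity μ PX ψ))
    -- the compact set, the kernel and the bandwidths
    (K : Set (E d)) (hK : IsCompact K)
    (k : E d → ℝ) (hk : IsSmoothingKernel k)
    (h : ℕ → ℝ) (hh_pos : ∀ n, 0 < h n) (hh_zero : Tendsto h atTop (𝓝 0))
    (hh_rate : Tendsto (fun n : ℕ => n * h n ^ d / |Real.log n|) atTop atTop) :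
    ∀ᵐ ψ ∂PΨ, ∀ᵐ ωs ∂(κs ψ), ∀ᵐ ω ∂(κ ψ), ∀ ε : ℝ, 0 < ε →
      TendstoUniformlyOn
        (fun (n : ℕ) (s : E d) =>
          cConst μ PX ψ K (extremalField fun i => xs i ωs) *
            correctedEstimator μ PX k h K (extremalField fun i => xs i ωs)
              (fun j i => x j i ω) n s)
        (fun s => ψ s) atTop (K + Metric.closedBall (0 : E d) (R - ε)) := by
  rcases K.eq_empty_or_nonempty with rfl | hne
  · simp [tendstoUniformlyOn_empty]
  have hX := ae_isShape hC.le hX_nonneg hX_bdd hX_pos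
  filter_upwards [hΨ_pos, hxs, hx] with ψ hψ hψs hψx
  filter_upwards [hψs.ae_extremalField_ne_top hX hK,
    hψs.ae_exists_le_extremalField hμ hR hψ hX hK] with ωs hy_top ⟨c, hc, hy⟩
  exact hψx.ae_tendstoUniformlyOn hk ⟨hh_pos, hh_zero, hh_rate⟩ hμ hR hψ hc hy hy_top hX hK hne
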